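/- Let $k\ge 2$ be an integer, let $c,\alpha>0$, and let $M_n=\exp^{(k)}(c\,n^{\alpha})$ for $n\ge 0$, where $\exp^{(k)}$ and $\log^{(k)}$ denote the $k$-fold iterates of $\exp$ and $\log$. Let $\mathcal C_M([-1,1])$ be the class of real-valued $\psi\in C^\infty([-1,1])$ for which there is a constant $K>0$ with $\sup_{t\in[-1,1]}|\psi^{(n)}(t)|\le K^{n+1}M_n$ for all $n\ge 0$. For a phase $\psi$ put $$m(\lambda)=\mathrm{p.v.}\int_{-1}^{1}e^{i\lambda\psi(t)}\,\frac{dt}{t}=\lim_{\varepsilon\downarrow0}\int_{\varepsilon\le|t|\le1}e^{i\lambda\psi(t)}\,\frac{dt}{t}.$$ (i) If $\psi\in\mathcal C_M([-1,1])$, then the principal value $m(\lambda)$ exists for every real $\lambda$, and $$m(\lambda)=O\!\left(\frac{\log\lambda}{(\log^{(k)}\lambda)^{1/\alpha}}\right)\qquad(\lambda\to\infty),$$ where the implicit constant may depend on $\psi$ but not on $\lambda$. (ii) This bound is sharp: there are constants $B>0$ and $\delta>0$, with $\log^{(j)}(1/\delta)\ge2$ for $1\le j\le k$, such that the function $$\psi(t)=\begin{cases}0,&-1\le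 t\le0,\\ \exp\!\Bigl(-B\,\log\frac1{\delta t}\,\bigl(\log^{(k)}\frac1{\delta t}\bigr)^{1/\alpha}\Bigr),&0<t\le1,\end{cases}$$ belongs to $\mathcal C_M([-1,1])$, is flat at $0$ (that is, $\psi^{(n)}(0)=0$ for all $n\ge0$), and, for some sequence $\lambda_n\to\infty$, satisfies $$C^{-1}\,\frac{\log\lambda_n}{(\log^{(k)}\lambda_n)^{1/\alpha}}\le|m(\lambda_n)|\le C\,\frac{\log\lambda_n}{(\log^{(k)}\lambda_n)^{1/\alpha}}$$ for all sufficiently large $n$, with a constant $C>0$ independent of $n$. -/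

import Mathlib

open Filter Topology Asymptotics
open scoped ContDiff

noncomputable section

namespace SteinWainger

/-- The interval `[-1, 1]`. -/
def I : Set ℝ := Set.Icc (-1) 1

/-- The integral over `ε ≤ |t| ≤ 1` of `exp (i lam ψ(t)) / t`. -/
def truncated (ψ : ℝ → ℝ) (lam ε : ℝ) : ℂ :=
  (∫ t in (-1 : ℝ)..(-ε), Complex.exp (Complex.I * lam * ψ t) / t) +
    ∫ t in ε..(1 : ℝ), Complex.exp (Complex.I * lam * ψ t) / t

/-- The principal value `p.v. ∫_{[-1,1]} exp (i lam ψ(t)) dt / t` exists and equals `z`. -/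
def HasPrincipalValue (ψ : ℝ → ℝ) (lam : ℝ) (z : ℂ) : Prop :=
  Tendsto (truncated ψ lam) (𝓝[>] 0) (𝓝 z)

/-- The Stein–Wainger oscillatory integral `m(lam)` with phase `ψ`, as a principal value. -/
def m (ψ : ℝ → ℝ) (lam : ℝ) : ℂ :=
  limUnder (𝓝[>] (0 : ℝ)) (truncated ψ lam)

/-- The Denjoy–Carleman class of real-valued functions on `[-1,1]` with weight sequence `M`. -/
def DenjoyCarleman (M : ℕ → ℝ) (ψ : ℝ → ℝ) : Prop :=
  ContDiffOn ℝ ∞ ψ I ∧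
    ∃ K : ℝ, 0 < K ∧ ∀ n : ℕ, ∀ t ∈ I, |iteratedDerivWithin n ψ I t| ≤ K ^ (n + 1) * M n

/-- `M_n = exp^{(k)} (c n^α)`. -/
def weight (k : ℕ) (c α : ℝ) (n : ℕ) : ℝ :=
  Real.exp^[k] (c * (n : ℝ) ^ α)

/-- `log x / (log^{(k)} x)^{1/α}`. -/
def growth (k : ℕ) (α x : ℝ) : ℝ :=
  Real.log x / (Real.log^[k] x) ^ (1 / α)

/-- The phase that is `0` for `t ≤ 0` and
`exp (-B log(1/(δt)) (log^{(k)} (1/(δt)))^{1/α})` for `t > 0`. -/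
def flatPhase (k : ℕ) (α B δ t : ℝ) : ℝ :=
  if t ≤ 0 then 0
  else Real.exp (-(B * Real.log (1 / (δ * t)) * (Real.log^[k] (1 / (δ * t))) ^ (1 / α)))

/-- All derivatives of `ψ` (including the zeroth) vanish at `0`. -/
def FlatAtZero (ψ : ℝ → ℝ) : Prop :=
  ∀ n : ℕ, iteratedDerivWithin n ψ I 0 = 0

end SteinWainger

end

/-! Folding `t` and `-t` together turns `m` into the integral over `(0, 1]` of `oddKernel`, which is
bounded by a Lipschitz estimate, so the principal value exists.

Upper bound (`DenjoyCarleman.m_isBigO_growth`): cut at `ε`. The part over `(ε, 1]` is at most `2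
log(1/ε)`. On `(0, ε]` replace `ψ` by its Taylor polynomial of degree `n` at `0`; the error is
governed by `lam * M_{n+1} * (K ε)^(n+1)`, and the polynomial contributes at most `39 (n+1)^5`
(`norm_setIntegral_oddKernel_polyPhase_le`), whatever its coefficients. With `n + 1` the integer
part of `(log^{(k)} lam / c)^{1/α}` one has `M_{n+1} ≤ lam`, so `ε` of size `lam^{-2/(n+1)}`
suffices and `log(1/ε)` has the size of `growth`. A bound polynomial in the degree is harmless: as
`k ≥ 2`, powers of `n` are small against `log lam`.

Sharpness: the flat phase extends holomorphically to discs of radius `η t` about `t`, with decay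
only slightly weaker than on the real axis (`complexPhase_estimate`). Cauchy's estimates then bound
its derivatives, giving flatness and, for suitable `B`, membership in the class
(`denjoyCarleman_flatPhase`). Since the phase vanishes on the left, `-Re m` is the integral of `(1 -
cos(lam ψ(t))) / t`, which has no cancellation. Averaging over `lam` between `4/ψ(t₀)` and `8/ψ(t₀)`
yields a frequency with `|m| ≥ log(1/t₀)/4` (`exists_integral_one_sub_cos_ge`), and `log(1/t₀)` is
comparable to `growth` there (`eventually_growth_le`). -/

noncomputable section

namespace SteinWainger

open MeasureTheory Set

/-! ### Van der Corput type estimate for monomial-like phases -/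

/-- Integration by parts against `1 / (t p'(t))` when `t p'(t)` behaves like a monomial. -/
theorem norm_integral_exp_phase_div_le {p q q' : ℝ → ℝ} {u v A : ℝ} {j : ℕ} (hj : 1 ≤ j)
    (hu : 0 < u) (huv : u ≤ v) (hA : 0 < A) (hAu : 1 ≤ A * u ^ j)
    (hp : ∀ t ∈ Icc u v, HasDerivAt p (q t / t) t)
    (hq : ∀ t ∈ Icc u v, HasDerivAt q (q' t) t)
    (hq'c : ContinuousOn q' (Icc u v))
    (hlow : ∀ t ∈ Icc u v, j * (A * t ^ j) ≤ 2 * |q t|)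
    (hup : ∀ t ∈ Icc u v, |t * q' t| ≤ 2 * j ^ 2 * (A * t ^ j)) :
    ‖∫ t in u..v, Complex.exp (Complex.I * p t) / t‖ ≤ 12 := by
  have hj1 : (1 : ℝ) ≤ j := by exact_mod_cast hj
  have hpos : ∀ t ∈ Icc u v, 0 < t := fun t ht => hu.trans_le ht.1
  have hAt : ∀ t ∈ Icc u v, 1 ≤ A * t ^ j := fun t ht =>
    hAu.trans (mul_le_mul_of_nonneg_left (pow_le_pow_left₀ hu.le ht.1 j) hA.le)
  have hqpos : ∀ t ∈ Icc u v, 1 ≤ 2 * |q t| := fun t ht => by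
    have := hlow t ht
    have := hAt t ht
    nlinarith
  have hq0 : ∀ t ∈ Icc u v, q t ≠ 0 := fun t ht h0 => by
    have := hqpos t ht
    simp [h0] at this
    linarith
  -- Since `p' = q / t`, the derivative of `F` is the integrand minus `R`; the final 12 is 2 + 2
  -- from the endpoints and 8 from `R`.
  set F : ℝ → ℂ := fun t => Complex.exp (Complex.I * p t) / (Complex.I * q t) with hF
  set R : ℝ → ℂ := fun t => Complex.exp (Complex.I * p t) * q' t / (Complex.I * q t ^ 2) with hR
  have hpc : ContinuousOn p (Icc u v) := fun t ht => (hp t ht).continuousAt.continuousWithinAt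
  have hqc : ContinuousOn q (Icc u v) := fun t ht => (hq t ht).continuousAt.continuousWithinAt
  have hec : ContinuousOn (fun t : ℝ => Complex.exp (Complex.I * p t)) (Icc u v) := by fun_prop
  have hnorm : ∀ t : ℝ, ‖Complex.exp (Complex.I * p t)‖ = 1 := fun t => by
    rw [mul_comm]; exact Complex.norm_exp_ofReal_mul_I _
  have hmainc : ContinuousOn (fun t : ℝ => Complex.exp (Complex.I * p t) / t) (Icc u v) :=
    hec.div (by fun_prop) fun t ht => by exact_mod_cast (hpos t ht).ne'
  have hRc : ContinuousOn R (Icc u v) := by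
    refine ContinuousOn.div (by fun_prop) (by fun_prop) fun t ht => ?_
    have := hq0 t ht
    simp [this]
  have hder : ∀ t ∈ uIcc u v,
      HasDerivAt F (Complex.exp (Complex.I * p t) / t - R t) t := by
    intro t ht
    rw [uIcc_of_le huv] at ht
    have h1 : HasDerivAt (fun t : ℝ => Complex.exp (Complex.I * p t))
        (Complex.exp (Complex.I * p t) * (Complex.I * ((q t / t : ℝ) : ℂ))) t :=
      (((hp t ht).ofReal_comp).const_mul Complex.I).cexp
    have h2 : HasDerivAt (fun t : ℝ => Complex.I * (q t : ℂ)) (Complex.I * (q' t : ℂ)) t :=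
      ((hq t ht).ofReal_comp).const_mul Complex.I
    have hqt : (q t : ℂ) ≠ 0 := by exact_mod_cast hq0 t ht
    have htt : (t : ℂ) ≠ 0 := by exact_mod_cast (hpos t ht).ne'
    refine (h1.div h2 (mul_ne_zero Complex.I_ne_zero hqt)).congr_deriv ?_
    have hI := Complex.I_ne_zero
    simp only [hR]
    push_cast
    field_simp
  have hint1 : IntervalIntegrable (fun t : ℝ => Complex.exp (Complex.I * p t) / t) volume u v :=
    ContinuousOn.intervalIntegrable (by rwa [uIcc_of_le huv])
  have hint2 : IntervalIntegrable R volume u v :=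
    ContinuousOn.intervalIntegrable (by rwa [uIcc_of_le huv])
  have hftc := intervalIntegral.integral_eq_sub_of_hasDerivAt hder (hint1.sub hint2)
  rw [intervalIntegral.integral_sub hint1 hint2] at hftc
  have hFb : ∀ t ∈ Icc u v, ‖F t‖ ≤ 2 := fun t ht => by
    simp only [hF, norm_div, hnorm, norm_mul, Complex.norm_I, one_mul, Complex.norm_real,
      Real.norm_eq_abs]
    rw [div_le_iff₀ (abs_pos.2 (hq0 t ht))]
    exact hqpos t ht
  -- The factor `j ^ 2` in `hup` cancels against the square of `hlow`, so the bound does not depend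
  -- on the degree.
  have hRb : ∀ t ∈ Icc u v, ‖R t‖ ≤ 8 / (A * t ^ (j + 1)) := fun t ht => by
    have ht0 := hpos t ht
    have hl := hlow t ht
    have hU := hup t ht
    rw [abs_mul, abs_of_pos ht0] at hU
    simp only [hR, norm_div, hnorm, norm_mul, Complex.norm_I, one_mul, Complex.norm_real,
      Real.norm_eq_abs, norm_pow]
    have hX : 0 < A * t ^ j := by positivity
    rw [div_le_div_iff₀ (pow_pos (abs_pos.2 (hq0 t ht)) 2) (by positivity)]
    have h4 : (j * (A * t ^ j)) ^ 2 ≤ (2 * |q t|) ^ 2 :=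
      pow_le_pow_left₀ (by positivity) hl 2
    calc |q' t| * (A * t ^ (j + 1)) = (t * |q' t|) * (A * t ^ j) := by ring
      _ ≤ (2 * j ^ 2 * (A * t ^ j)) * (A * t ^ j) := by gcongr
      _ ≤ 8 * |q t| ^ 2 := by nlinarith
  have hcont8 : ContinuousOn (fun t : ℝ => 8 / (A * t ^ (j + 1))) (uIcc u v) := by
    rw [uIcc_of_le huv]
    exact ContinuousOn.div (by fun_prop) (by fun_prop) fun t ht => by
      have := hpos t ht
      positivity
  have h8 : ∫ t in u..v, 8 / (A * t ^ (j + 1)) ≤ 8 := by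
    have hd : ∀ t ∈ uIcc u v,
        HasDerivAt (fun t : ℝ => -(8 / (j * A)) * (t ^ j)⁻¹) (8 / (A * t ^ (j + 1))) t := by
      intro t ht
      rw [uIcc_of_le huv] at ht
      have ht0 := hpos t ht
      refine (((hasDerivAt_pow j t).inv (by positivity)).const_mul (-(8 / (j * A)))).congr_deriv ?_
      obtain ⟨i, rfl⟩ : ∃ i, j = i + 1 := ⟨j - 1, by omega⟩
      simp only [Nat.add_sub_cancel]
      field_simp
      ring
    rw [intervalIntegral.integral_eq_sub_of_hasDerivAt hd hcont8.intervalIntegrable]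
    have hv : 0 < v := hu.trans_le huv
    have h1 : 0 ≤ 8 / (j * A) * (v ^ j)⁻¹ := by positivity
    have h2 : 8 / (j * A) * (u ^ j)⁻¹ ≤ 8 := by
      rw [← div_eq_mul_inv, div_div, div_le_iff₀ (by positivity)]
      nlinarith
    linarith
  have hRint : ‖∫ t in u..v, R t‖ ≤ 8 :=
    (intervalIntegral.norm_integral_le_of_norm_le huv
      (ae_of_all _ fun t ht => hRb t (Ioc_subset_Icc_self ht)) hcont8.intervalIntegrable).trans h8
  have : ∫ t in u..v, Complex.exp (Complex.I * p t) / t = F v - F u + ∫ t in u..v, R t := by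
    rw [← hftc]; ring
  rw [this]
  calc _ ≤ ‖F v‖ + ‖F u‖ + ‖∫ t in u..v, R t‖ :=
        (norm_add_le _ _).trans (add_le_add_left (norm_sub_le _ _) _)
    _ ≤ 2 + 2 + 8 := add_le_add (add_le_add (hFb v ⟨huv, le_rfl⟩) (hFb u ⟨le_rfl, huv⟩)) hRint
    _ = 12 := by norm_num

/-! ### Polynomial phases and dominant monomials -/

/-- The polynomial `∑_{1 ≤ j ≤ d} a_j t^j`. -/
def polyPhase (a : ℕ → ℝ) (d : ℕ) (t : ℝ) : ℝ := ∑ i ∈ Finset.Icc 1 d, a i * t ^ i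

/-- The set of `t > 0` at which the `j`-th monomial dominates each other monomial by a factor
`N`. -/
def dominantSet (a : ℕ → ℝ) (d : ℕ) (N : ℝ) (j : ℕ) : Set ℝ :=
  {t | 0 < t ∧ ∀ i ∈ Finset.Icc 1 d, i ≠ j → N * (|a i| * t ^ i) ≤ |a j| * t ^ j}

theorem polyPhase_neg (a : ℕ → ℝ) (d : ℕ) (t : ℝ) :
    polyPhase a d (-t) = polyPhase (fun i => (-1) ^ i * a i) d t := by
  unfold polyPhase
  refine Finset.sum_congr rfl fun i _ => ?_
  rw [neg_pow]; ring

theorem continuous_polyPhase (a : ℕ → ℝ) (d : ℕ) : Continuous (polyPhase a d) := by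
  unfold polyPhase; fun_prop

theorem hasDerivAt_polyPhase (a : ℕ → ℝ) (d : ℕ) {t : ℝ} (ht : t ≠ 0) :
    HasDerivAt (polyPhase a d) (polyPhase (fun i => i * a i) d t / t) t := by
  unfold polyPhase
  rw [Finset.sum_div]
  refine HasDerivAt.fun_sum fun i hi => ?_
  refine ((hasDerivAt_pow i t).const_mul (a i)).congr_deriv ?_
  obtain ⟨l, rfl⟩ : ∃ l, i = l + 1 := ⟨i - 1, by have := (Finset.mem_Icc.1 hi).1; omega⟩
  simp only [Nat.add_sub_cancel]
  field_simp
  ring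

section Dominant

variable {a : ℕ → ℝ} {d : ℕ} {N : ℝ} {j : ℕ}

theorem dominantSet_neg : dominantSet (fun i => (-1) ^ i * a i) d N j = dominantSet a d N j := by
  simp [dominantSet, abs_mul, abs_pow]

/-- The quotient of the monomials `j` and `i` is a monotone power of `t`: for `i < j` domination
propagates to the right from `u`, for `i > j` to the left from `v`. -/
theorem ordConnected_dominantSet (hN : 0 ≤ N) : (dominantSet a d N j).OrdConnected := by
  refine ⟨fun u hu v hv t ht => ?_⟩
  have hu0 : 0 < u := hu.1
  have ht0 : 0 < t := hu0.trans_le ht.1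
  refine ⟨ht0, fun i hi hij => ?_⟩
  rcases lt_or_gt_of_ne hij with h | h
  · obtain ⟨e, rfl⟩ := Nat.exists_eq_add_of_lt h
    have h1 := hu.2 i hi hij
    have h2 : N * |a i| ≤ |a (i + e + 1)| * u ^ (e + 1) := by
      refine le_of_mul_le_mul_right ?_ (pow_pos hu0 i)
      calc _ = N * (|a i| * u ^ i) := by ring
        _ ≤ _ := h1
        _ = _ := by ring
    calc N * (|a i| * t ^ i) = N * |a i| * t ^ i := by ring
      _ ≤ |a (i + e + 1)| * u ^ (e + 1) * t ^ i := by gcongr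
      _ ≤ |a (i + e + 1)| * t ^ (e + 1) * t ^ i := by gcongr; exact ht.1
      _ = _ := by ring
  · obtain ⟨e, rfl⟩ := Nat.exists_eq_add_of_lt h
    have hv0 : 0 < v := hv.1
    have h1 := hv.2 _ hi hij
    have h2 : N * |a (j + e + 1)| * v ^ (e + 1) ≤ |a j| := by
      refine le_of_mul_le_mul_right ?_ (pow_pos hv0 j)
      calc _ = N * (|a (j + e + 1)| * v ^ (j + e + 1)) := by ring
        _ ≤ _ := h1
    calc N * (|a (j + e + 1)| * t ^ (j + e + 1))
        = N * |a (j + e + 1)| * t ^ (e + 1) * t ^ j := by ring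
      _ ≤ N * |a (j + e + 1)| * v ^ (e + 1) * t ^ j := by gcongr; exact ht.2
      _ ≤ |a j| * t ^ j := by gcongr

theorem measurableSet_dominantSet (hN : 0 ≤ N) : MeasurableSet (dominantSet a d N j) :=
  (ordConnected_dominantSet hN).measurableSet

/-- On the dominant set, weighted sums of the remaining monomials are small. -/
theorem sum_erase_mul_le (hj : j ∈ Finset.Icc 1 d) (hN : 2 * (d : ℝ) ^ 3 ≤ N) {t : ℝ}
    (ht : t ∈ dominantSet a d N j) {b : ℕ → ℝ} (hb : ∀ i ∈ Finset.Icc 1 d, |b i| ≤ d ^ 2) :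
    ∑ i ∈ (Finset.Icc 1 d).erase j, |b i * a i * t ^ i| ≤ |a j| * t ^ j / 2 := by
  have ht0 : 0 < t := ht.1
  have hd : (0 : ℝ) < d := by
    have := Finset.mem_Icc.1 hj
    exact_mod_cast (by omega : 0 < d)
  set X := |a j| * t ^ j
  have hX : 0 ≤ X := by positivity
  have hterm : ∀ i ∈ (Finset.Icc 1 d).erase j, |b i * a i * t ^ i| ≤ X / (2 * d) := by
    intro i hi
    rw [Finset.mem_erase] at hi
    have h1 := ht.2 i hi.2 hi.1
    have h0 : 0 ≤ |a i| * t ^ i := by positivity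
    rw [abs_mul, abs_mul, abs_of_pos (pow_pos ht0 i), le_div_iff₀ (by positivity)]
    calc |b i| * |a i| * t ^ i * (2 * d) = |b i| * (2 * d) * (|a i| * t ^ i) := by ring
      _ ≤ d ^ 2 * (2 * d) * (|a i| * t ^ i) := by gcongr; exact hb i hi.2
      _ = 2 * d ^ 3 * (|a i| * t ^ i) := by ring
      _ ≤ N * (|a i| * t ^ i) := by gcongr
      _ ≤ X := h1
  calc _ ≤ ((Finset.Icc 1 d).erase j).card • (X / (2 * d)) := Finset.sum_le_card_nsmul _ _ _ hterm
    _ ≤ (d : ℝ) * (X / (2 * d)) := by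
        rw [nsmul_eq_mul]
        gcongr
        exact (Finset.card_erase_le).trans (by simp)
    _ = X / 2 := by field_simp

/-- The weights `b` equal to `1`, `i` and `i ^ 2` treat the polynomial, its Euler derivative `t p'`
and the second Euler derivative at once. -/
theorem abs_polyPhase_sub_le (hj : j ∈ Finset.Icc 1 d) (hN : 2 * (d : ℝ) ^ 3 ≤ N) {t : ℝ}
    (ht : t ∈ dominantSet a d N j) {b : ℕ → ℝ} (hb : ∀ i ∈ Finset.Icc 1 d, |b i| ≤ d ^ 2) :
    |polyPhase (fun i => b i * a i) d t - b j * a j * t ^ j| ≤ |a j| * t ^ j / 2 := by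
  unfold polyPhase
  rw [← Finset.add_sum_erase _ _ hj, add_sub_cancel_left]
  exact (Finset.abs_sum_le_sum_abs _ _).trans (sum_erase_mul_le hj hN ht hb)

/-- On the dominant set `t p'` and its Euler derivative differ from `j a_j t^j` and `j ^ 2 a_j t^j`
by at most half of `|a_j| t^j`, so the integration by parts applies with `A = |a j|`. -/
theorem norm_integral_polyPhase_le (hj : j ∈ Finset.Icc 1 d) (hN : 2 * (d : ℝ) ^ 3 ≤ N)
    (haj : a j ≠ 0) {u v : ℝ} (huv : u ≤ v) (hsub : Icc u v ⊆ dominantSet a d N j)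
    (hu : 1 ≤ |a j| * u ^ j) :
    ‖∫ t in u..v, Complex.exp (Complex.I * polyPhase a d t) / t‖ ≤ 12 := by
  have hu0 : 0 < u := (hsub ⟨le_rfl, huv⟩).1
  have hj' := Finset.mem_Icc.1 hj
  have hj1 : (1 : ℝ) ≤ j := by exact_mod_cast hj'.1
  have hpos : ∀ t ∈ Icc u v, 0 < t := fun t ht => (hsub ht).1
  refine norm_integral_exp_phase_div_le (q := polyPhase (fun i => i * a i) d)
    (q' := fun t => polyPhase (fun i => i * (i * a i)) d t / t) hj'.1 hu0 huv (abs_pos.2 haj) hu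
    (fun t ht => hasDerivAt_polyPhase a d (hpos t ht).ne')
    (fun t ht => hasDerivAt_polyPhase _ d (hpos t ht).ne')
    ((continuous_polyPhase _ d).continuousOn.div continuousOn_id fun t ht => (hpos t ht).ne')
    (fun t ht => ?_) (fun t ht => ?_)
  · have h := abs_polyPhase_sub_le hj hN (hsub ht) (b := fun i => (i : ℝ)) (fun i hi => by
      have := Finset.mem_Icc.1 hi
      have h1 : (1 : ℝ) ≤ i := by exact_mod_cast this.1
      have h2 : (i : ℝ) ≤ d := by exact_mod_cast this.2
      rw [abs_of_nonneg (by positivity)]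
      nlinarith)
    have ht0 := hpos t ht
    have h3 : |(j : ℝ) * a j * t ^ j| = j * (|a j| * t ^ j) := by
      rw [abs_mul, abs_mul, abs_of_pos (pow_pos ht0 j), abs_of_nonneg (by positivity : (0:ℝ) ≤ j)]
      ring
    have h4 := abs_sub_abs_le_abs_sub ((j : ℝ) * a j * t ^ j) (polyPhase (fun i => i * a i) d t)
    rw [abs_sub_comm] at h4
    have hX : 0 ≤ |a j| * t ^ j := by positivity
    nlinarith
  · have h := abs_polyPhase_sub_le hj hN (hsub ht) (b := fun i => (i : ℝ) ^ 2) (fun i hi => by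
      have := Finset.mem_Icc.1 hi
      have h2 : (i : ℝ) ≤ d := by exact_mod_cast this.2
      rw [abs_of_nonneg (by positivity)]
      gcongr)
    have ht0 := hpos t ht
    have h3 : |(j : ℝ) ^ 2 * a j * t ^ j| = j ^ 2 * (|a j| * t ^ j) := by
      rw [abs_mul, abs_mul, abs_of_pos (pow_pos ht0 j),
        abs_of_nonneg (by positivity : (0:ℝ) ≤ (j : ℝ) ^ 2)]
      ring
    have h4 := abs_sub_abs_le_abs_sub (polyPhase (fun i => (i : ℝ) ^ 2 * a i) d t)
      ((j : ℝ) ^ 2 * a j * t ^ j)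
    have hX : 0 ≤ |a j| * t ^ j := by positivity
    have h5 : (fun i : ℕ => (i : ℝ) * (i * a i)) = fun i : ℕ => (i : ℝ) ^ 2 * a i := by
      ext i; ring
    rw [mul_div_cancel₀ _ ht0.ne', h5]
    have h6 : |a j| * t ^ j ≤ (j : ℝ) ^ 2 * (|a j| * t ^ j) :=
      le_mul_of_one_le_left hX (one_le_pow₀ hj1)
    linarith

end Dominant

/-! ### The odd kernel -/

/-- The odd part `(e^{i φ(t)} - e^{i φ(-t)}) / t` of the oscillatory kernel. -/
def oddKernel (φ : ℝ → ℝ) (t : ℝ) : ℂ :=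
  (Complex.exp (Complex.I * φ t) - Complex.exp (Complex.I * φ (-t))) / t

theorem norm_exp_I_mul_sub_le (x y : ℝ) :
    ‖Complex.exp (Complex.I * x) - Complex.exp (Complex.I * y)‖ ≤ |x - y| := by
  have h : Complex.exp (Complex.I * x) - Complex.exp (Complex.I * y)
      = Complex.exp (Complex.I * y) * (Complex.exp (Complex.I * (x - y : ℝ)) - 1) := by
    rw [mul_sub, ← Complex.exp_add, mul_one]
    congr 2
    push_cast; ring
  rw [h, norm_mul, mul_comm Complex.I (y : ℂ), Complex.norm_exp_ofReal_mul_I, one_mul]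
  exact Real.norm_exp_I_mul_ofReal_sub_one_le

theorem norm_oddKernel_le (φ : ℝ → ℝ) {t : ℝ} (ht : 0 < t) : ‖oddKernel φ t‖ ≤ 2 / t := by
  rw [oddKernel, norm_div, Complex.norm_real, Real.norm_of_nonneg ht.le]
  gcongr
  refine (norm_sub_le _ _).trans ?_
  rw [mul_comm, Complex.norm_exp_ofReal_mul_I, mul_comm, Complex.norm_exp_ofReal_mul_I]
  norm_num

theorem norm_oddKernel_le_abs_sub (φ : ℝ → ℝ) {t : ℝ} (ht : 0 < t) :
    ‖oddKernel φ t‖ ≤ |φ t - φ (-t)| / t := by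
  rw [oddKernel, norm_div, Complex.norm_real, Real.norm_of_nonneg ht.le]
  gcongr
  exact norm_exp_I_mul_sub_le _ _

theorem norm_oddKernel_sub_le (φ χ : ℝ → ℝ) {t : ℝ} (ht : 0 < t) :
    ‖oddKernel φ t - oddKernel χ t‖ ≤ (|φ t - χ t| + |φ (-t) - χ (-t)|) / t := by
  rw [oddKernel, oddKernel, ← sub_div, norm_div, Complex.norm_real, Real.norm_of_nonneg ht.le]
  gcongr
  rw [sub_sub_sub_comm]
  exact (norm_sub_le _ _).trans
    (add_le_add (norm_exp_I_mul_sub_le _ _) (norm_exp_I_mul_sub_le _ _))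

theorem integrableOn_oddKernel {φ : ℝ → ℝ} {C b : ℝ} (hφ : ContinuousOn φ (Icc (-b) b))
    (hC : ∀ t ∈ Ioc 0 b, |φ t - φ (-t)| ≤ C * t) : IntegrableOn (oddKernel φ) (Ioc 0 b) := by
  have h1 : ContinuousOn φ (Ioc 0 b) := hφ.mono fun t ht =>
    ⟨by have := ht.1; have := ht.2; linarith, ht.2⟩
  have h2 : ContinuousOn (fun t => φ (-t)) (Ioc 0 b) :=
    hφ.comp continuousOn_neg fun t ht =>
      ⟨by have := ht.1; have := ht.2; linarith, by have := ht.1; have := ht.2; linarith⟩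
  have hc : ContinuousOn (oddKernel φ) (Ioc 0 b) := by
    unfold oddKernel
    have h1' := Complex.continuous_ofReal.comp_continuousOn h1
    have h2' := Complex.continuous_ofReal.comp_continuousOn h2
    exact ContinuousOn.div ((continuousOn_const.mul h1').cexp.sub (continuousOn_const.mul h2').cexp)
      (by fun_prop) fun t ht => by exact_mod_cast ht.1.ne'
  refine IntegrableOn.of_bound (C := C) (by simp)
    (hc.aestronglyMeasurable measurableSet_Ioc) ?_
  refine (ae_restrict_mem measurableSet_Ioc).mono fun t ht => ?_
  refine (norm_oddKernel_le_abs_sub φ ht.1).trans ?_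
  rw [div_le_iff₀ ht.1]
  exact hC t ht

/-! ### Crossings of monomials: the set where none dominates -/

/-- The crossing point of the monomials `|a_i| t^i` and `|a_j| t^j`. -/
def crossing (a : ℕ → ℝ) (i j : ℕ) : ℝ := (|a i| / |a j|) ^ (1 / ((j : ℝ) - i))

/-- Near a crossing point in the multiplicative sense. -/
def nearCrossing (a : ℕ → ℝ) (N : ℝ) (i j : ℕ) : Set ℝ :=
  Icc (crossing a i j / N) (crossing a i j * N)

theorem crossing_pos {a : ℕ → ℝ} {i j : ℕ} (hi : a i ≠ 0) (hj : a j ≠ 0) :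
    0 < crossing a i j :=
  Real.rpow_pos_of_pos (div_pos (abs_pos.2 hi) (abs_pos.2 hj)) _

theorem crossing_comm (a : ℕ → ℝ) (i j : ℕ) : crossing a i j = crossing a j i := by
  unfold crossing
  rw [← inv_div (|a j|) (|a i|), Real.inv_rpow (by positivity), ← Real.rpow_neg (by positivity)]
  congr 1
  rw [← neg_sub, one_div, one_div, inv_neg, neg_neg]

theorem crossing_pow {a : ℕ → ℝ} {i e : ℕ} : 
    crossing a i (i + e + 1) ^ (e + 1) = |a i| / |a (i + e + 1)| := by
  unfold crossing
  rw [← Real.rpow_natCast, ← Real.rpow_mul (by positivity)]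
  have : 1 / (((i + e + 1 : ℕ) : ℝ) - i) * ((e + 1 : ℕ) : ℝ) = 1 := by
    push_cast
    have : (i : ℝ) + e + 1 - i = e + 1 := by ring
    rw [this, one_div, inv_mul_cancel₀ (by positivity)]
  rw [this, Real.rpow_one]

/-- The quotient of the two monomials is a power of `t / crossing a i j` with nonzero integer
exponent, so a quotient between 1 and `N` puts `t` within a factor `N` of the crossing. -/
theorem mem_nearCrossing {a : ℕ → ℝ} {N : ℝ} (hN : 1 ≤ N) {i j : ℕ} (hij : i ≠ j) {t : ℝ}
    (ht : 0 < t) (hi : a i ≠ 0) (hj : a j ≠ 0) (h1 : |a i| * t ^ i ≤ |a j| * t ^ j)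
    (h2 : |a j| * t ^ j ≤ N * (|a i| * t ^ i)) : t ∈ nearCrossing a N i j := by
  have hN0 : 0 < N := by linarith
  have hc := crossing_pos hi hj
  have hai := abs_pos.2 hi
  have haj := abs_pos.2 hj
  unfold nearCrossing
  rcases lt_or_gt_of_ne hij with h | h
  · obtain ⟨e, rfl⟩ := Nat.exists_eq_add_of_lt h
    have hp := crossing_pow (a := a) (i := i) (e := e)
    set x := crossing a i (i + e + 1)
    have hti := pow_pos ht i
    have h1' : |a i| ≤ |a (i + e + 1)| * t ^ (e + 1) := by
      refine le_of_mul_le_mul_right (h1.trans_eq ?_) hti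
      ring
    have h2' : |a (i + e + 1)| * t ^ (e + 1) ≤ N * |a i| := by
      refine le_of_mul_le_mul_right (Eq.trans_le ?_ (h2.trans_eq ?_)) hti <;> ring
    have hx1 : x ≤ t := by
      refine le_of_pow_le_pow_left₀ (Nat.succ_ne_zero e) ht.le ?_
      rw [hp, div_le_iff₀ haj, mul_comm]; exact h1'
    have hx2 : t ≤ x * N := by
      refine le_of_pow_le_pow_left₀ (Nat.succ_ne_zero e) (by positivity) ?_
      rw [mul_pow, hp]
      calc t ^ (e + 1) ≤ |a i| / |a (i + e + 1)| * N := by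
            rw [div_mul_eq_mul_div, le_div_iff₀ haj]; linarith
        _ ≤ _ := by gcongr; exact le_self_pow₀ hN (Nat.succ_ne_zero e)
    exact ⟨(div_le_self hc.le hN).trans hx1, hx2⟩
  · rw [crossing_comm]
    rw [crossing_comm] at hc
    obtain ⟨e, rfl⟩ := Nat.exists_eq_add_of_lt h
    have hp := crossing_pow (a := a) (i := j) (e := e)
    set x := crossing a j (j + e + 1)
    have htj := pow_pos ht j
    have h1' : |a (j + e + 1)| * t ^ (e + 1) ≤ |a j| := by
      refine le_of_mul_le_mul_right (Eq.trans_le ?_ h1) htj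
      ring
    have h2' : |a j| ≤ N * |a (j + e + 1)| * t ^ (e + 1) := by
      refine le_of_mul_le_mul_right (h2.trans_eq ?_) htj
      ring
    have hx1 : t ≤ x := by
      refine le_of_pow_le_pow_left₀ (Nat.succ_ne_zero e) hc.le ?_
      rw [hp, le_div_iff₀ hai, mul_comm]; exact h1'
    have hx2 : x ≤ t * N := by
      refine le_of_pow_le_pow_left₀ (Nat.succ_ne_zero e) (by positivity) ?_
      rw [mul_pow, hp]
      calc |a j| / |a (j + e + 1)| ≤ t ^ (e + 1) * N := by
            rw [div_le_iff₀ hai]; linarith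
        _ ≤ _ := by gcongr; exact le_self_pow₀ hN (Nat.succ_ne_zero e)
    exact ⟨(div_le_iff₀ hN0).2 hx2, hx1.trans (le_mul_of_one_le_right hc.le hN)⟩

/-- The density `2 / t` on the set near a crossing point. -/
def crossingWeight (a : ℕ → ℝ) (N : ℝ) (i j : ℕ) : ℝ → ℝ :=
  if a i ≠ 0 ∧ a j ≠ 0 then (nearCrossing a N i j).indicator fun t => 2 / t else 0

theorem crossingWeight_nonneg {a : ℕ → ℝ} {N : ℝ} (hN : 1 ≤ N) (i j : ℕ) (t : ℝ) :
    0 ≤ crossingWeight a N i j t := by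
  unfold crossingWeight
  split_ifs with h
  · refine indicator_nonneg (fun t ht => ?_) t
    have : 0 < t := (div_pos (crossing_pos h.1 h.2) (by linarith)).trans_le ht.1
    positivity
  · exact le_rfl

theorem integrable_crossingWeight {a : ℕ → ℝ} {N : ℝ} (hN : 1 ≤ N) (i j : ℕ) :
    Integrable (crossingWeight a N i j) := by
  unfold crossingWeight
  split_ifs with h
  · refine (ContinuousOn.integrableOn_Icc ?_).integrable_indicator measurableSet_Icc
    refine ContinuousOn.div (by fun_prop) (by fun_prop) fun t ht => ?_
    exact ((div_pos (crossing_pos h.1 h.2) (by linarith)).trans_le ht.1).ne'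
  · exact integrable_zero _ _ _

theorem integral_crossingWeight_le {a : ℕ → ℝ} {N : ℝ} (hN : 1 ≤ N) (i j : ℕ) :
    ∫ t, crossingWeight a N i j t ≤ 4 * N := by
  unfold crossingWeight
  split_ifs with h
  · have hx := crossing_pos h.1 h.2
    have hN0 : 0 < N := by linarith
    rw [integral_indicator (by exact measurableSet_Icc), nearCrossing, integral_Icc_eq_integral_Ioc,
      ← intervalIntegral.integral_of_le
        ((div_le_self hx.le hN).trans (le_mul_of_one_le_right hx.le hN))]
    simp_rw [div_eq_mul_inv (2 : ℝ)]
    rw [intervalIntegral.integral_const_mul,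
      integral_inv_of_pos (by positivity) (by positivity)]
    -- The interval has logarithmic length `2 log N` wherever the crossing lies, which is why the
    -- coefficients do not matter.
    have : crossing a i j * N / (crossing a i j / N) = N * N := by field_simp
    rw [this, Real.log_mul hN0.ne' hN0.ne']
    have := Real.log_le_self hN0.le
    linarith
  · simp; linarith

/-- Outside the dominant sets the kernel is controlled by the crossing weights. -/
theorem norm_oddKernel_le_sum_crossingWeight {a : ℕ → ℝ} {d : ℕ} {N : ℝ} (hN : 1 ≤ N) {t : ℝ}
    (ht : 0 < t)
    (hbad : ∀ j ∈ Finset.Icc 1 d, a j ≠ 0 → t ∉ dominantSet a d N j) :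
    ‖oddKernel (polyPhase a d) t‖
      ≤ ∑ i ∈ Finset.Icc 1 d, ∑ j ∈ Finset.Icc 1 d, crossingWeight a N i j t := by
  have hnn : ∀ i j, 0 ≤ crossingWeight a N i j t := fun i j => crossingWeight_nonneg hN i j t
  by_cases hz : ∀ i ∈ Finset.Icc 1 d, a i = 0
  · have : ∀ s, polyPhase a d s = 0 := fun s =>
      Finset.sum_eq_zero fun i hi => by rw [hz i hi, zero_mul]
    simp only [oddKernel, this, sub_self, zero_div, norm_zero]
    exact Finset.sum_nonneg fun i _ => Finset.sum_nonneg fun j _ => hnn i j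
  · push Not at hz
    obtain ⟨l, hl, hal⟩ := hz
    -- The largest monomial at `t` fails to dominate some other one by the factor `N`, so `t` is
    -- near the crossing of these two.
    obtain ⟨j, hj, hmax⟩ := Finset.exists_max_image (Finset.Icc 1 d) (fun i => |a i| * t ^ i) ⟨l, hl⟩
    have haj : a j ≠ 0 := fun h0 => by
      have := hmax l hl
      rw [h0, abs_zero, zero_mul] at this
      have := mul_pos (abs_pos.2 hal) (pow_pos ht l)
      linarith
    have hb := hbad j hj haj
    simp only [dominantSet, mem_ofPred_eq, ht, true_and, not_forall, not_le] at hb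
    obtain ⟨i, hi, hij, hlt⟩ := hb
    have hai : a i ≠ 0 := fun h0 => by
      rw [h0, abs_zero, zero_mul, mul_zero] at hlt
      exact absurd hlt (not_lt.2 (by positivity))
    have hmem := mem_nearCrossing hN hij ht hai haj (hmax i hi) hlt.le
    have hval : crossingWeight a N i j t = 2 / t := by
      rw [crossingWeight, if_pos ⟨hai, haj⟩, indicator_of_mem hmem]
    calc _ ≤ 2 / t := norm_oddKernel_le _ ht
      _ = crossingWeight a N i j t := hval.symm
      _ ≤ ∑ j ∈ Finset.Icc 1 d, crossingWeight a N i j t :=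
          Finset.single_le_sum (fun j _ => hnn i j) hj
      _ ≤ _ := Finset.single_le_sum
          (f := fun i => ∑ j ∈ Finset.Icc 1 d, crossingWeight a N i j t)
          (fun i _ => Finset.sum_nonneg fun j _ => hnn i j) hi

theorem abs_polyPhase_sub_neg_le {a : ℕ → ℝ} {d : ℕ} {N : ℝ} {j : ℕ} (hj : j ∈ Finset.Icc 1 d)
    (hN : 2 * (d : ℝ) ^ 3 ≤ N) {t : ℝ} (ht : t ∈ dominantSet a d N j) :
    |polyPhase a d t - polyPhase a d (-t)| ≤ 3 * (|a j| * t ^ j) := by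
  have ht0 : 0 < t := ht.1
  have hd : ∀ i ∈ Finset.Icc 1 d, |(fun _ => 1 : ℕ → ℝ) i| ≤ (d : ℝ) ^ 2 := fun i hi => by
    have h := Finset.mem_Icc.1 hi
    have : (1 : ℝ) ≤ d := by exact_mod_cast h.1.trans h.2
    rw [abs_one]
    exact one_le_pow₀ this
  have h1 := abs_polyPhase_sub_le hj hN ht hd
  have h2 := abs_polyPhase_sub_le hj hN
    (a := fun i => (-1) ^ i * a i) (by rwa [dominantSet_neg]) hd
  simp only [one_mul] at h1 h2
  rw [← polyPhase_neg, abs_mul, abs_pow, abs_neg, abs_one, one_pow, one_mul] at h2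
  have h3 : |a j * t ^ j - (-1) ^ j * a j * t ^ j| ≤ 2 * (|a j| * t ^ j) := by
    refine (abs_sub _ _).trans ?_
    simp only [abs_mul, abs_pow, abs_neg, abs_one, one_pow, one_mul, abs_of_pos ht0]
    linarith
  rw [abs_le] at *
  constructor <;> linarith [h1.1, h1.2, h2.1, h2.2, h3.1, h3.2]

theorem exists_abs_polyPhase_sub_neg_le (a : ℕ → ℝ) (d : ℕ) (b : ℝ) :
    ∃ C, ∀ t ∈ Ioc 0 b, |polyPhase a d t - polyPhase a d (-t)| ≤ C * t := by
  refine ⟨∑ i ∈ Finset.Icc 1 d, 2 * |a i| * b ^ (i - 1), fun t ht => ?_⟩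
  have ht0 : 0 < t := ht.1
  unfold polyPhase
  rw [← Finset.sum_sub_distrib, Finset.sum_mul]
  refine (Finset.abs_sum_le_sum_abs _ _).trans (Finset.sum_le_sum fun i hi => ?_)
  obtain ⟨l, rfl⟩ : ∃ l, i = l + 1 := ⟨i - 1, by have := (Finset.mem_Icc.1 hi).1; omega⟩
  refine (abs_sub _ _).trans ?_
  simp only [abs_mul, abs_pow, abs_neg, abs_of_pos ht0, Nat.add_sub_cancel]
  calc |a (l + 1)| * t ^ (l + 1) + |a (l + 1)| * t ^ (l + 1)
      = 2 * |a (l + 1)| * t ^ l * t := by ring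
    _ ≤ 2 * |a (l + 1)| * b ^ l * t := by gcongr; exact ht.2

theorem integrableOn_oddKernel_polyPhase (a : ℕ → ℝ) (d : ℕ) (b : ℝ) :
    IntegrableOn (oddKernel (polyPhase a d)) (Ioc 0 b) :=
  let ⟨_, hC⟩ := exists_abs_polyPhase_sub_neg_le a d b
  integrableOn_oddKernel (continuous_polyPhase a d).continuousOn hC

/-- Split at `w`, where `|a j| * w ^ j = 1`. Below `w` the kernel is at most `3 |a_j| t^(j-1)`, with
integral at most 3; above it, integration by parts costs 12 for each of the phases at `t` and `-t`.
-/
theorem norm_setIntegral_dominantSet_le {a : ℕ → ℝ} {d : ℕ} {N : ℝ} {j : ℕ}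
    (hj : j ∈ Finset.Icc 1 d) (hN : 2 * (d : ℝ) ^ 3 ≤ N) (haj : a j ≠ 0) (b : ℝ) :
    ‖∫ t in Ioc 0 b ∩ dominantSet a d N j, oddKernel (polyPhase a d) t‖ ≤ 27 := by
  have hj1 : 1 ≤ j := (Finset.mem_Icc.1 hj).1
  have hN0 : 0 ≤ N := le_trans (by positivity) hN
  have hA := abs_pos.2 haj
  set G := dominantSet a d N j with hG
  set w : ℝ := |a j|⁻¹ ^ (1 / (j : ℝ)) with hw
  have hw0 : 0 < w := Real.rpow_pos_of_pos (inv_pos.2 hA) _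
  have hwj : |a j| * w ^ j = 1 := by
    rw [hw, ← Real.rpow_natCast, ← Real.rpow_mul (by positivity),
      one_div_mul_cancel (by positivity), Real.rpow_one, mul_inv_cancel₀ hA.ne']
  have hGm : MeasurableSet G := measurableSet_dominantSet hN0
  have hint : IntegrableOn (oddKernel (polyPhase a d)) (Ioc 0 b ∩ G) :=
    (integrableOn_oddKernel_polyPhase a d b).mono_set inter_subset_left
  rw [← integral_inter_add_sdiff (measurableSet_Iio (a := w)) hint]
  have hsmall : ‖∫ t in Ioc 0 b ∩ G ∩ Iio w, oddKernel (polyPhase a d) t‖ ≤ 3 := by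
    have hmaj : IntegrableOn (fun t : ℝ => 3 * |a j| * t ^ (j - 1)) (Ioc 0 w) :=
      ((Continuous.continuousOn (by fun_prop)).integrableOn_Icc (a := 0) (b := w)).mono_set
        Ioc_subset_Icc_self
    have hsub : Ioc 0 b ∩ G ∩ Iio w ⊆ Ioc 0 w := fun t ht => ⟨ht.1.1.1, ht.2.le⟩
    have hmeas : MeasurableSet (Ioc 0 b ∩ G ∩ Iio w) :=
      (measurableSet_Ioc.inter hGm).inter measurableSet_Iio
    calc _ ≤ ∫ t in Ioc 0 b ∩ G ∩ Iio w, 3 * |a j| * t ^ (j - 1) := by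
          refine norm_integral_le_of_norm_le (hmaj.mono_set hsub) ?_
          refine (ae_restrict_mem hmeas).mono fun t ht => ?_
          have ht0 : 0 < t := ht.1.1.1
          refine (norm_oddKernel_le_abs_sub _ ht0).trans ?_
          rw [div_le_iff₀ ht0]
          refine (abs_polyPhase_sub_neg_le hj hN ht.1.2).trans_eq ?_
          obtain ⟨l, rfl⟩ : ∃ l, j = l + 1 := ⟨j - 1, by omega⟩
          simp only [Nat.add_sub_cancel]
          ring
      _ ≤ ∫ t in Ioc 0 w, 3 * |a j| * t ^ (j - 1) := by
          refine setIntegral_mono_set hmaj ?_ (LE.le.eventuallyLE hsub)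
          refine (ae_restrict_mem measurableSet_Ioc).mono fun t ht => ?_
          have ht0 : 0 < t := ht.1
          simp only [Pi.zero_apply]
          positivity
      _ = 3 * |a j| * (w ^ j / j) := by
          rw [← intervalIntegral.integral_of_le hw0.le, intervalIntegral.integral_const_mul,
            integral_pow]
          obtain ⟨l, rfl⟩ : ∃ l, j = l + 1 := ⟨j - 1, by omega⟩
          simp
      _ = 3 / j := by
          rw [mul_assoc, ← mul_div_assoc, hwj, mul_one_div]
      _ ≤ 3 := div_le_self (by norm_num) (by exact_mod_cast hj1)
  have hlarge : ‖∫ t in (Ioc 0 b ∩ G) \ Iio w, oddKernel (polyPhase a d) t‖ ≤ 24 := by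
    rcases ((Ioc 0 b ∩ G) \ Iio w).eq_empty_or_nonempty with he | hne
    · rw [he]; simp
    -- A nonempty compact order-connected set is a closed interval, as the integration by parts
    -- requires.
    have hcomp : IsCompact ((Ioc 0 b ∩ G) \ Iio w) := by
      have : (Ioc 0 b ∩ G) \ Iio w = Icc w b ∩ ⋂ i ∈ Finset.Icc 1 d, ⋂ (_ : i ≠ j),
          {t : ℝ | N * (|a i| * t ^ i) ≤ |a j| * t ^ j} := by
        ext t
        simp only [hG, dominantSet, Set.mem_sdiff, mem_inter_iff, mem_Ioc, mem_ofPred_eq, mem_Iio,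
          not_lt, mem_Icc, mem_iInter]
        constructor
        · rintro ⟨⟨⟨_, h2⟩, _, h4⟩, h5⟩
          exact ⟨⟨h5, h2⟩, h4⟩
        · rintro ⟨⟨h5, h2⟩, h4⟩
          exact ⟨⟨⟨hw0.trans_le h5, h2⟩, hw0.trans_le h5, h4⟩, h5⟩
      rw [this]
      refine isCompact_Icc.inter_right (isClosed_biInter fun i _ => isClosed_iInter fun _ => ?_)
      exact isClosed_le (by fun_prop) (by fun_prop)
    have hord : ((Ioc 0 b ∩ G) \ Iio w).OrdConnected := by
      rw [Set.sdiff_eq, compl_Iio]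
      exact (ordConnected_Ioc.inter (ordConnected_dominantSet hN0)).inter ordConnected_Ici
    have hIcc := eq_Icc_of_connected_compact ⟨hne, hord.isPreconnected⟩ hcomp
    set u := sInf ((Ioc 0 b ∩ G) \ Iio w)
    set v := sSup ((Ioc 0 b ∩ G) \ Iio w)
    rw [hIcc] at hne
    have huv : u ≤ v := nonempty_Icc.1 hne
    have hsub : Icc u v ⊆ G := fun t ht => by rw [← hIcc] at ht; exact ht.1.2
    have hwu : w ≤ u := by
      have : u ∈ Icc u v := ⟨le_rfl, huv⟩
      rw [← hIcc] at this
      exact not_lt.1 this.2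
    have hu0 := hw0.trans_le hwu
    have hu1 : 1 ≤ |a j| * u ^ j := by
      rw [← hwj]; gcongr
    rw [hIcc, integral_Icc_eq_integral_Ioc, ← intervalIntegral.integral_of_le huv]
    have hc : ∀ a' : ℕ → ℝ, IntervalIntegrable
        (fun t : ℝ => Complex.exp (Complex.I * polyPhase a' d t) / t) volume u v := fun a' => by
      refine ContinuousOn.intervalIntegrable ?_
      rw [uIcc_of_le huv]
      have := continuous_polyPhase a' d
      refine ContinuousOn.div (Continuous.continuousOn (by fun_prop)) (by fun_prop) fun t ht => ?_
      exact_mod_cast (hu0.trans_le ht.1).ne'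
    simp_rw [oddKernel, sub_div, polyPhase_neg]
    rw [intervalIntegral.integral_sub (hc _) (hc _)]
    refine (norm_sub_le _ _).trans ?_
    have h1 := norm_integral_polyPhase_le hj hN haj huv hsub hu1
    have h2 := norm_integral_polyPhase_le (a := fun i => (-1) ^ i * a i) hj hN
      (by simpa using haj) huv (by rwa [dominantSet_neg]) (by simpa [abs_mul, abs_pow] using hu1)
    linarith
  exact (norm_add_le _ _).trans (by linarith)

/-- Stein–Wainger for polynomial phases with a bound polynomial in the degree. -/
theorem norm_setIntegral_oddKernel_polyPhase_le (a : ℕ → ℝ) (d : ℕ) (b : ℝ) :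
    ‖∫ t in Ioc 0 b, oddKernel (polyPhase a d) t‖ ≤ 39 * ((d : ℝ) + 1) ^ 5 := by
  classical
  -- The term `2 d^3` makes the other monomials a small perturbation; the extra 2 makes the dominant
  -- sets of nonzero monomials disjoint, also for small `d`.
  set N : ℝ := 2 * (d : ℝ) ^ 3 + 2 with hNdef
  have hN : 2 * (d : ℝ) ^ 3 ≤ N := by rw [hNdef]; linarith
  have hN2 : 2 ≤ N := by
    have : (0 : ℝ) ≤ 2 * (d : ℝ) ^ 3 := by positivity
    linarith
  have hN1 : 1 ≤ N := by linarith
  set f := oddKernel (polyPhase a d)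
  have hint : IntegrableOn f (Ioc 0 b) := integrableOn_oddKernel_polyPhase a d b
  set S := (Finset.Icc 1 d).filter fun j => a j ≠ 0 with hS
  have hmS : ∀ {j}, j ∈ S ↔ j ∈ Finset.Icc 1 d ∧ a j ≠ 0 := by simp [hS]
  set U : Set ℝ := ⋃ j ∈ S, dominantSet a d N j with hU
  have hGm : ∀ j, MeasurableSet (dominantSet a d N j) := fun j =>
    measurableSet_dominantSet (by linarith)
  have hUm : MeasurableSet U := S.measurableSet_biUnion fun j _ => hGm j
  rw [← integral_inter_add_sdiff hUm hint]
  have hgood : ‖∫ t in Ioc 0 b ∩ U, f t‖ ≤ 27 * d := by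
    rw [hU, inter_iUnion₂, integral_biUnion_finset S
      (fun j _ => measurableSet_Ioc.inter (hGm j)) ?_
      (fun j _ => hint.mono_set inter_subset_left)]
    · refine (norm_sum_le _ _).trans ?_
      calc _ ≤ S.card • (27 : ℝ) := Finset.sum_le_card_nsmul _ _ _ fun j hj =>
            norm_setIntegral_dominantSet_le (hmS.1 hj).1 hN (hmS.1 hj).2 b
        _ ≤ 27 * d := by
            rw [nsmul_eq_mul, mul_comm]
            gcongr
            exact (Finset.card_filter_le _ _).trans (by simp)
    · intro i hi j hj hij
      have hi' := hmS.1 hi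
      have hj' := hmS.1 hj
      refine Set.disjoint_left.2 fun t hti htj => ?_
      have ht0 : 0 < t := hti.1.1
      have h1 := hti.2.2 j hj'.1 hij.symm
      have h2 := htj.2.2 i hi'.1 hij
      have h3 := mul_pos (abs_pos.2 hi'.2) (pow_pos ht0 i)
      have h4 := mul_pos (abs_pos.2 hj'.2) (pow_pos ht0 j)
      nlinarith
  have hbad : ‖∫ t in Ioc 0 b \ U, f t‖ ≤ d * (d * (4 * N)) := by
    have hIw : ∀ i, Integrable fun t => ∑ j ∈ Finset.Icc 1 d, crossingWeight a N i j t :=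
      fun i => integrable_finsetSum _ fun j _ => integrable_crossingWeight hN1 i j
    have hI : Integrable fun t =>
        ∑ i ∈ Finset.Icc 1 d, ∑ j ∈ Finset.Icc 1 d, crossingWeight a N i j t :=
      integrable_finsetSum _ fun i _ => hIw i
    calc _ ≤ ∫ t in Ioc 0 b \ U,
          ∑ i ∈ Finset.Icc 1 d, ∑ j ∈ Finset.Icc 1 d, crossingWeight a N i j t := by
          refine norm_integral_le_of_norm_le hI.integrableOn ?_
          refine (ae_restrict_mem (measurableSet_Ioc.diff hUm)).mono fun t ht => ?_
          refine norm_oddKernel_le_sum_crossingWeight hN1 ht.1.1 fun j hj haj hmem => ht.2 ?_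
          exact mem_biUnion (hmS.2 ⟨hj, haj⟩) hmem
      _ ≤ ∫ t, ∑ i ∈ Finset.Icc 1 d, ∑ j ∈ Finset.Icc 1 d, crossingWeight a N i j t :=
          setIntegral_le_integral hI (ae_of_all _ fun t => Finset.sum_nonneg fun i _ =>
            Finset.sum_nonneg fun j _ => crossingWeight_nonneg hN1 i j t)
      _ = ∑ i ∈ Finset.Icc 1 d, ∑ j ∈ Finset.Icc 1 d, ∫ t, crossingWeight a N i j t := by
          rw [integral_finsetSum _ fun i _ => hIw i]
          exact Finset.sum_congr rfl fun i _ =>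
            integral_finsetSum _ fun j _ => integrable_crossingWeight hN1 i j
      _ ≤ ∑ i ∈ Finset.Icc 1 d, ∑ j ∈ Finset.Icc 1 d, 4 * N :=
          Finset.sum_le_sum fun i _ => Finset.sum_le_sum fun j _ =>
            integral_crossingWeight_le hN1 i j
      _ = d * (d * (4 * N)) := by simp
  -- The fifth power comes from `d ^ 2` pairs of monomials, each costing `4 N` with `N` of order `d
  -- ^ 3`.
  refine (norm_add_le _ _).trans ((add_le_add hgood hbad).trans ?_)
  rw [hNdef]
  have hd0 : (0 : ℝ) ≤ d := by positivity
  have h2 := pow_nonneg hd0 2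
  have h3 := pow_nonneg hd0 3
  have h4 := pow_nonneg hd0 4
  have h5 := pow_nonneg hd0 5
  ring_nf
  nlinarith

/-- A constant phase is a unimodular factor; it is needed for the term `lam * ψ 0` of the Taylor
polynomial. -/
theorem norm_setIntegral_oddKernel_const_add_le (θ : ℝ) (a : ℕ → ℝ) (d : ℕ) (b : ℝ) :
    IntegrableOn (oddKernel fun t => θ + polyPhase a d t) (Ioc 0 b) ∧
    ‖∫ t in Ioc 0 b, oddKernel (fun t => θ + polyPhase a d t) t‖ ≤ 39 * ((d : ℝ) + 1) ^ 5 := by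
  have h : (oddKernel fun t => θ + polyPhase a d t) =
      fun t => Complex.exp (Complex.I * θ) * oddKernel (polyPhase a d) t := by
    ext t
    simp only [oddKernel, Complex.ofReal_add, mul_add, Complex.exp_add]
    ring
  rw [h]
  refine ⟨(integrableOn_oddKernel_polyPhase a d b).const_mul _, ?_⟩
  rw [integral_const_mul, norm_mul, mul_comm Complex.I (θ : ℂ), Complex.norm_exp_ofReal_mul_I,
    one_mul]
  exact norm_setIntegral_oddKernel_polyPhase_le a d b

/-! ### Existence of the principal value and Taylor approximation -/

section PrincipalValue

theorem uniqueDiffOn_I : UniqueDiffOn ℝ I := uniqueDiffOn_Icc (by norm_num)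

theorem mem_I_of_mem_Ioc {t : ℝ} (ht : t ∈ Ioc (0 : ℝ) 1) : t ∈ I ∧ -t ∈ I := by
  have h1 := ht.1
  have h2 := ht.2
  exact ⟨⟨by linarith, h2⟩, ⟨by linarith, by linarith⟩⟩

variable {M : ℕ → ℝ} {ψ : ℝ → ℝ}

theorem DenjoyCarleman.exists_abs_sub_neg_le (hψ : DenjoyCarleman M ψ) :
    ∃ C, ∀ t ∈ Ioc (0 : ℝ) 1, |ψ t - ψ (-t)| ≤ C * t := by
  obtain ⟨hs, K, hK, hb⟩ := hψ
  refine ⟨K ^ 2 * M 1 * 2, fun t ht => ?_⟩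
  obtain ⟨h1, h2⟩ := mem_I_of_mem_Ioc ht
  have hd : DifferentiableOn ℝ ψ I := hs.differentiableOn (by simp)
  have := Convex.norm_image_sub_le_of_norm_derivWithin_le (C := K ^ 2 * M 1) hd (fun x hx => by
    have := hb 1 x hx
    rwa [iteratedDerivWithin_one] at this) (convex_Icc (-1 : ℝ) 1) h2 h1
  rw [Real.norm_eq_abs, Real.norm_eq_abs] at this
  refine this.trans_eq ?_
  rw [sub_neg_eq_add, abs_of_pos (by have := ht.1; linarith)]
  ring

theorem DenjoyCarleman.integrableOn_oddKernel (hψ : DenjoyCarleman M ψ) (lam : ℝ) :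
    IntegrableOn (oddKernel fun t => lam * ψ t) (Ioc 0 1) := by
  obtain ⟨C, hC⟩ := hψ.exists_abs_sub_neg_le
  refine SteinWainger.integrableOn_oddKernel (C := |lam| * C)
    (continuousOn_const.mul hψ.1.continuousOn) fun t ht => ?_
  rw [← mul_sub, abs_mul, mul_assoc]
  gcongr
  exact hC t ht

theorem truncated_eq_integral_oddKernel (hψ : ContinuousOn ψ I) (lam : ℝ) {ε : ℝ} (h0 : 0 < ε)
    (h1 : ε ≤ 1) :
    truncated ψ lam ε = ∫ t in ε..1, oddKernel (fun t => lam * ψ t) t := by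
  have hc : ∀ χ : ℝ → ℝ, ContinuousOn χ (Icc ε 1) → IntervalIntegrable
      (fun t : ℝ => Complex.exp (Complex.I * lam * χ t) / t) volume ε 1 := fun χ hχ => by
    refine ContinuousOn.intervalIntegrable ?_
    rw [uIcc_of_le h1]
    have := Complex.continuous_ofReal.comp_continuousOn hχ
    refine ContinuousOn.div (continuousOn_const.mul this).cexp (by fun_prop) fun t ht => ?_
    exact_mod_cast (h0.trans_le ht.1).ne'
  have hpos : ContinuousOn ψ (Icc ε 1) := hψ.mono (Icc_subset_Icc (by linarith) le_rfl)
  have hneg : ContinuousOn (fun t => ψ (-t)) (Icc ε 1) := hψ.comp continuousOn_neg fun t ht =>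
    ⟨by linarith [ht.2], by linarith [ht.1]⟩
  have hrefl : ∫ t in (-1 : ℝ)..(-ε), Complex.exp (Complex.I * lam * ψ t) / t
      = ∫ t in ε..1, -(Complex.exp (Complex.I * lam * ψ (-t)) / t) := by
    rw [← intervalIntegral.integral_comp_neg]
    refine intervalIntegral.integral_congr fun t _ => ?_
    simp [div_neg]
  rw [truncated, hrefl, intervalIntegral.integral_neg, neg_add_eq_sub,
    ← intervalIntegral.integral_sub (hc _ hpos) (hc _ hneg)]
  refine intervalIntegral.integral_congr fun t _ => ?_
  simp only [oddKernel, Complex.ofReal_mul, mul_assoc]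
  ring

theorem DenjoyCarleman.hasPrincipalValue (hψ : DenjoyCarleman M ψ) (lam : ℝ) :
    HasPrincipalValue ψ lam (∫ t in Ioc 0 1, oddKernel (fun t => lam * ψ t) t) := by
  have hint := hψ.integrableOn_oddKernel lam
  have hc := intervalIntegral.continuousOn_primitive_interval_left (μ := volume)
    (f := oddKernel fun t => lam * ψ t) (a := 0) (b := 1)
    (by rwa [uIcc_of_le zero_le_one, integrableOn_Icc_iff_integrableOn_Ioc])
  have h0 := hc 0 (by simp)
  rw [uIcc_of_le zero_le_one] at h0
  have h1 : Tendsto (fun ε => ∫ t in ε..1, oddKernel (fun t => lam * ψ t) t) (𝓝[>] 0)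
      (𝓝 (∫ t in (0 : ℝ)..1, oddKernel (fun t => lam * ψ t) t)) := by
    refine h0.mono_left ?_
    rw [← nhdsWithin_Ioc_eq_nhdsGT (zero_lt_one (α := ℝ))]
    exact nhdsWithin_mono _ Ioc_subset_Icc_self
  rw [← intervalIntegral.integral_of_le zero_le_one]
  refine h1.congr' ?_
  filter_upwards [Ioc_mem_nhdsGT (zero_lt_one (α := ℝ))] with ε hε
  exact (truncated_eq_integral_oddKernel hψ.1.continuousOn lam hε.1 hε.2).symm

theorem DenjoyCarleman.m_eq (hψ : DenjoyCarleman M ψ) (lam : ℝ) :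
    m ψ lam = ∫ t in Ioc 0 1, oddKernel (fun t => lam * ψ t) t :=
  (hψ.hasPrincipalValue lam).limUnder_eq

/-- Taylor's formula at the interior point `0` with bound on the remainder. -/
theorem abs_sub_taylor_le (hψ : ContDiffOn ℝ ∞ ψ I) {n : ℕ} {R : ℝ}
    (hR : ∀ t ∈ I, |iteratedDerivWithin (n + 1) ψ I t| ≤ R) {t : ℝ} (ht : t ∈ I) :
    |ψ t - (ψ 0 + polyPhase (fun i => (i.factorial : ℝ)⁻¹ * iteratedDerivWithin i ψ I 0) n t)|
      ≤ R * |t| ^ (n + 1) := by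
  have h0I : (0 : ℝ) ∈ I := ⟨by norm_num, by norm_num⟩
  rcases eq_or_ne 0 t with rfl | hne
  · have : polyPhase (fun i => (i.factorial : ℝ)⁻¹ * iteratedDerivWithin i ψ I 0) n 0 = 0 :=
      Finset.sum_eq_zero fun i hi => by
        rw [zero_pow (by have := (Finset.mem_Icc.1 hi).1; omega), mul_zero]
    simp [this]
  have hsub : uIcc 0 t ⊆ I := uIcc_subset_Icc h0I ht
  have hud : UniqueDiffOn ℝ (uIcc 0 t) := by
    refine uniqueDiffOn_Icc ?_
    rcases lt_or_gt_of_ne hne with h | h <;> simp [h]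
  -- Lagrange's remainder lives on the segment from `0` to `t`, whose derivatives must be matched
  -- with those within `I`.
  have hder : ∀ i : ℕ, ∀ x ∈ uIcc 0 t,
      iteratedDerivWithin i ψ (uIcc 0 t) x = iteratedDerivWithin i ψ I x := fun i x hx => by
    rw [iteratedDerivWithin, iteratedDerivWithin,
      iteratedFDerivWithin_subset hsub hud uniqueDiffOn_I (hψ.of_le (by exact_mod_cast le_top)) hx]
  have hψt := hψ.mono hsub
  obtain ⟨x, hx, hxe⟩ := taylor_mean_remainder_lagrange (n := n) hne
    (hψt.of_le (by exact_mod_cast le_top))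
    ((hψt.differentiableOn_iteratedDerivWithin (by exact_mod_cast WithTop.coe_lt_top _) hud).mono
      uIoo_subset_uIcc_self)
  have hx' := uIoo_subset_uIcc_self hx
  rw [hder _ x hx', sub_zero] at hxe
  have hpoly : taylorWithinEval ψ n (uIcc 0 t) 0 t
      = ψ 0 + polyPhase (fun i => (i.factorial : ℝ)⁻¹ * iteratedDerivWithin i ψ I 0) n t := by
    rw [taylor_within_apply, Finset.range_eq_Ico, Finset.sum_eq_sum_Ico_succ_bot (by omega),
      polyPhase]
    congr 1
    · simp
    · refine Finset.sum_congr (by ext; simp) fun i _ => ?_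
      rw [hder i 0 left_mem_uIcc, sub_zero, smul_eq_mul]
      ring
  rw [← hpoly, hxe, abs_div, abs_mul, abs_pow, Nat.abs_cast]
  refine (div_le_self (by positivity) (by exact_mod_cast Nat.succ_le_of_lt (Nat.factorial_pos _))).trans ?_
  gcongr
  exact hR x (hsub hx')

theorem norm_setIntegral_oddKernel_Ioc_le (φ : ℝ → ℝ) {ε : ℝ} (h0 : 0 < ε) (h1 : ε ≤ 1) :
    ‖∫ t in Ioc ε 1, oddKernel φ t‖ ≤ 2 * Real.log ε⁻¹ := by
  have hc : ContinuousOn (fun t : ℝ => 2 * t⁻¹) (Icc ε 1) :=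
    continuousOn_const.mul (continuousOn_id.inv₀ fun t ht => (h0.trans_le ht.1).ne')
  calc _ ≤ ∫ t in Ioc ε 1, 2 * t⁻¹ := by
        refine norm_integral_le_of_norm_le (hc.integrableOn_Icc.mono_set Ioc_subset_Icc_self) ?_
        refine (ae_restrict_mem measurableSet_Ioc).mono fun t ht => ?_
        rw [← div_eq_mul_inv]
        exact norm_oddKernel_le φ (h0.trans ht.1)
    _ = _ := by
        rw [← intervalIntegral.integral_of_le h1, intervalIntegral.integral_const_mul,
          integral_inv_of_pos h0 one_pos, one_div]

/-- The three terms are the trivial bound on `(ε, 1]`, the Taylor error on `(0, ε]` and the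
polynomial estimate; `n` and `ε` stay free for later optimization. -/
theorem DenjoyCarleman.norm_m_le (hψ : DenjoyCarleman M ψ) {n : ℕ} {R : ℝ} (hR0 : 0 ≤ R)
    (hR : ∀ t ∈ I, |iteratedDerivWithin (n + 1) ψ I t| ≤ R) {lam ε : ℝ} (hlam : 0 ≤ lam)
    (h0 : 0 < ε) (h1 : ε ≤ 1) :
    ‖m ψ lam‖ ≤ 2 * Real.log ε⁻¹ + 2 * lam * R * ε ^ (n + 1) + 39 * ((n : ℝ) + 1) ^ 5 := by
  have hint := hψ.integrableOn_oddKernel lam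
  set a : ℕ → ℝ := fun i => (i.factorial : ℝ)⁻¹ * iteratedDerivWithin i ψ I 0
  have htay : ∀ t ∈ I, |ψ t - (ψ 0 + polyPhase a n t)| ≤ R * |t| ^ (n + 1) := fun t ht =>
    abs_sub_taylor_le hψ.1 hR ht
  set χ : ℝ → ℝ := fun t => lam * ψ 0 + polyPhase (fun i => lam * a i) n t with hχ
  have hχe : ∀ t, χ t = lam * (ψ 0 + polyPhase a n t) := fun t => by
    simp only [hχ, polyPhase, mul_add, Finset.mul_sum, mul_assoc]
  obtain ⟨hχint, hχb⟩ :=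
    norm_setIntegral_oddKernel_const_add_le (lam * ψ 0) (fun i => lam * a i) n ε
  have hdiff : ∀ t ∈ I, |lam * ψ t - χ t| ≤ lam * (R * |t| ^ (n + 1)) := fun t ht => by
    rw [hχe, ← mul_sub, abs_mul, abs_of_nonneg hlam]
    gcongr
    exact htay t ht
  have hint0 : IntegrableOn (oddKernel fun t => lam * ψ t) (Ioc 0 ε) :=
    hint.mono_set (Ioc_subset_Ioc le_rfl h1)
  have herr : ‖∫ t in Ioc 0 ε, (oddKernel (fun t => lam * ψ t) t - oddKernel χ t)‖
      ≤ 2 * lam * R * ε ^ (n + 1) := by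
    refine (norm_setIntegral_le_of_norm_le_const (C := 2 * lam * R * ε ^ n) (by simp)
      fun t ht => ?_).trans_eq ?_
    · have ht0 : 0 < t := ht.1
      obtain ⟨hm1, hm2⟩ := mem_I_of_mem_Ioc ⟨ht0, ht.2.trans h1⟩
      refine (norm_oddKernel_sub_le _ _ ht0).trans ?_
      rw [div_le_iff₀ ht0]
      have e1 := hdiff t hm1
      have e2 := hdiff (-t) hm2
      rw [abs_neg] at e2
      rw [abs_of_pos ht0] at e1 e2
      calc _ ≤ lam * (R * t ^ (n + 1)) + lam * (R * t ^ (n + 1)) := add_le_add e1 e2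
        _ = 2 * lam * R * t ^ n * t := by ring
        _ ≤ 2 * lam * R * ε ^ n * t := by gcongr; exact ht.2
    · simp only [measureReal_def, Real.volume_Ioc, sub_zero, ENNReal.toReal_ofReal h0.le]
      ring
  rw [integral_sub hint0 hχint] at herr
  have hsplit : ∫ t in Ioc 0 1, oddKernel (fun t => lam * ψ t) t
      = (∫ t in Ioc 0 ε, oddKernel (fun t => lam * ψ t) t)
        + ∫ t in Ioc ε 1, oddKernel (fun t => lam * ψ t) t := by
    rw [← setIntegral_union (Ioc_disjoint_Ioc_of_le le_rfl) measurableSet_Ioc hint0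
      (hint.mono_set (Ioc_subset_Ioc h0.le le_rfl)), Ioc_union_Ioc_eq_Ioc h0.le h1]
  rw [hψ.m_eq, hsplit]
  have h3 := norm_setIntegral_oddKernel_Ioc_le (fun t => lam * ψ t) h0 h1
  have h4 : ‖∫ t in Ioc 0 ε, oddKernel (fun t => lam * ψ t) t‖
      ≤ 2 * lam * R * ε ^ (n + 1) + 39 * ((n : ℝ) + 1) ^ 5 := by
    have := norm_add_le ((∫ t in Ioc 0 ε, oddKernel (fun t => lam * ψ t) t)
      - ∫ t in Ioc 0 ε, oddKernel χ t) (∫ t in Ioc 0 ε, oddKernel χ t)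
    rw [sub_add_cancel] at this
    linarith
  exact (norm_add_le _ _).trans (by linarith)

end PrincipalValue

/-! ### Iterated logarithms at infinity and the upper bound -/

section IteratedLog

theorem tendsto_iterate_log_atTop (j : ℕ) : Tendsto Real.log^[j] atTop atTop := by
  induction j with
  | zero => exact tendsto_id
  | succ j ih =>
    rw [Function.iterate_succ']
    exact Real.tendsto_log_atTop.comp ih

theorem eventually_iterate_log_le (j : ℕ) : ∀ᶠ y in atTop, Real.log^[j] y ≤ y := by
  induction j with
  | zero => exact Eventually.of_forall fun y => le_rfl
  | succ j ih =>
    filter_upwards [ih, (tendsto_iterate_log_atTop j).eventually_ge_atTop 0] with y h1 h2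
    rw [Function.iterate_succ_apply']
    exact (Real.log_le_self h2).trans h1

theorem eventually_iterate_exp_iterate_log (j : ℕ) :
    ∀ᶠ y in atTop, Real.exp^[j] (Real.log^[j] y) = y := by
  induction j with
  | zero => exact Eventually.of_forall fun y => rfl
  | succ j ih =>
    filter_upwards [ih, (tendsto_iterate_log_atTop j).eventually_gt_atTop 0] with y h1 h2
    rw [Function.iterate_succ_apply, Function.iterate_succ_apply', Real.exp_log h2, h1]

theorem monotone_iterate_exp (j : ℕ) : Monotone Real.exp^[j] := Real.exp_monotone.iterate j

end IteratedLog

theorem weight_pos {k : ℕ} (hk : 1 ≤ k) (c α : ℝ) (n : ℕ) : 0 < weight k c α n := by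
  obtain ⟨i, rfl⟩ : ∃ i, k = i + 1 := ⟨k - 1, by omega⟩
  rw [weight, Function.iterate_succ_apply']
  exact Real.exp_pos _

theorem DenjoyCarleman.m_isBigO_growth {k : ℕ} (hk : 2 ≤ k) {c α : ℝ} (hc : 0 < c) (hα : 0 < α)
    {ψ : ℝ → ℝ} (hψ : DenjoyCarleman (weight k c α) ψ) :
    (fun lam : ℝ => m ψ lam) =O[atTop] (fun lam : ℝ => growth k α lam) := by
  obtain ⟨K₀, hK₀, hb₀⟩ := hψ.2
  -- Enlarging the constant to at least 1 ensures `ε ≤ 1` below.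
  set K := K₀ + 1 with hKdef
  have hK1 : 1 ≤ K := by linarith
  have hw : ∀ n, 0 < weight k c α n := weight_pos (by omega) c α
  have hb : ∀ n : ℕ, ∀ t ∈ I, |iteratedDerivWithin n ψ I t| ≤ K ^ (n + 1) * weight k c α n :=
    fun n t ht => (hb₀ n t ht).trans <|
      mul_le_mul_of_nonneg_right (pow_le_pow_left₀ hK₀.le (by linarith) _) (hw n).le
  set x : ℝ → ℝ := fun lam => (Real.log^[k] lam / c) ^ (1 / α) with hx
  have hxtop : Tendsto x atTop atTop :=
    (tendsto_rpow_atTop (by positivity)).comp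
      ((tendsto_iterate_log_atTop k).atTop_div_const hc)
  -- Here `k ≥ 2` enters: `x` is at most a power of `log log lam`. The exponent is 5 for the
  -- polynomial estimate plus 1 for the division by `X`.
  have hx6 : ∀ᶠ lam in atTop, x lam ^ 6 ≤ Real.log lam := by
    obtain ⟨i, rfl⟩ : ∃ i, k = i + 2 := ⟨k - 2, by omega⟩
    have h1 : ∀ᶠ y in atTop, ‖Real.log y ^ (6 / α)‖ ≤ (c ^ (6 / α)) * ‖y ^ (1 : ℝ)‖ :=
      (isLittleO_log_rpow_rpow_atTop (6 / α) one_pos).bound (by positivity)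
    have hll := Real.tendsto_log_atTop.comp Real.tendsto_log_atTop
    filter_upwards [Real.tendsto_log_atTop.eventually h1,
      hll.eventually (eventually_iterate_log_le i), hll.eventually_ge_atTop 0,
      Real.tendsto_log_atTop.eventually_ge_atTop 0,
      (tendsto_iterate_log_atTop (i + 2)).eventually_ge_atTop 0] with lam h2 h3 h4 h5 h6
    simp only [Function.comp_apply] at h3 h4
    rw [Real.rpow_one, Real.norm_of_nonneg h5,
      Real.norm_of_nonneg (Real.rpow_nonneg h4 _)] at h2
    have h7 : Real.log^[i + 2] lam ≤ Real.log (Real.log lam) := by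
      rwa [Function.iterate_add_apply]
    calc x lam ^ 6 = (Real.log^[i + 2] lam / c) ^ (6 / α) := by
          simp only [hx]
          rw [← Real.rpow_natCast, ← Real.rpow_mul (by positivity)]
          congr 1
          push_cast; ring
      _ ≤ (Real.log (Real.log lam) / c) ^ (6 / α) := by gcongr
      _ ≤ Real.log lam := by
          rw [Real.div_rpow h4 hc.le, div_le_iff₀ (by positivity), mul_comm]
          exact h2
  -- The constant collects `2 * 4 + 39` and `2 K + 2 K`; the factor `c ^ (1 / α)` converts `growth`
  -- into `log lam / X`.
  refine IsBigO.of_bound ((47 + 4 * K) * c ^ (1 / α)) ?_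
  filter_upwards [hxtop.eventually_ge_atTop 1, hx6, eventually_iterate_exp_iterate_log k,
    (tendsto_iterate_log_atTop k).eventually_gt_atTop 0, eventually_ge_atTop 1]
    with lam hx1 hx6 hel hl0 hlam1
  have hlam0 : 0 < lam := by linarith
  have hlog0 : 0 ≤ Real.log lam := Real.log_nonneg hlam1
  set X := x lam with hX
  obtain ⟨n, hn⟩ : ∃ n, ⌊X⌋₊ = n + 1 :=
    ⟨⌊X⌋₊ - 1, by have := (Nat.one_le_floor_iff X).2 hx1; omega⟩
  have hnX : ((n : ℝ) + 1) ≤ X := by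
    have := Nat.floor_le (by linarith : 0 ≤ X)
    rw [hn] at this
    exact_mod_cast this
  have hXn : X ≤ 2 * ((n : ℝ) + 1) := by
    have := (Nat.lt_floor_add_one X).le
    rw [hn] at this
    push_cast at this
    have : (0 : ℝ) ≤ n := by positivity
    linarith
  have hweight : weight k c α (n + 1) ≤ lam := by
    rw [weight]
    conv_rhs => rw [← hel]
    refine monotone_iterate_exp k ?_
    have h1 : (((n + 1 : ℕ) : ℝ)) ^ α ≤ X ^ α := by
      push_cast
      gcongr
    have h2 : X ^ α = Real.log^[k] lam / c := by
      rw [hX, hx, ← Real.rpow_mul (by positivity), one_div_mul_cancel hα.ne', Real.rpow_one]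
    rw [h2, le_div_iff₀ hc] at h1
    linarith
  -- In `ε ^ (n + 1)` one power of `lam` pays for the frequency, the other for the weight, and `K`
  -- absorbs the geometric factor.
  set ε : ℝ := (lam ^ (2 / ((n : ℝ) + 1)) * K)⁻¹ with hε
  have hn1 : (0 : ℝ) < (n : ℝ) + 1 := by positivity
  have hlp : 1 ≤ lam ^ (2 / ((n : ℝ) + 1)) := Real.one_le_rpow hlam1 (by positivity)
  have hε0 : 0 < ε := by positivity
  have hε1 : ε ≤ 1 := inv_le_one_of_one_le₀ (one_le_mul_of_one_le_of_one_le hlp hK1)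
  have hεn : ε ^ (n + 1) = (lam ^ 2 * K ^ (n + 1))⁻¹ := by
    rw [hε, inv_pow, mul_pow, ← Real.rpow_natCast (lam ^ _), ← Real.rpow_mul hlam0.le]
    push_cast
    rw [div_mul_cancel₀ _ hn1.ne']
    norm_num
  have hbound := hψ.norm_m_le (n := n) (R := K ^ (n + 2) * weight k c α (n + 1))
    (mul_nonneg (by positivity) (hw _).le) (hb (n + 1)) hlam0.le hε0 hε1
  have hmid : 2 * lam * (K ^ (n + 2) * weight k c α (n + 1)) * ε ^ (n + 1) ≤ 2 * K := by
    rw [hεn, ← div_eq_mul_inv, div_le_iff₀ (by positivity)]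
    calc _ ≤ 2 * lam * (K ^ (n + 2) * lam) := by gcongr
      _ = _ := by ring
  have hlogε : Real.log ε⁻¹ ≤ 4 * Real.log lam / X + K := by
    rw [hε, inv_inv, Real.log_mul (by positivity) (by positivity), Real.log_rpow hlam0]
    refine add_le_add ?_ (Real.log_le_self (by linarith))
    rw [div_mul_eq_mul_div, div_le_div_iff₀ hn1 (by linarith)]
    nlinarith
  have hX0 : 0 < X := by linarith
  have hX5 : X ^ 5 ≤ Real.log lam / X := by
    rw [le_div_iff₀ hX0]
    calc X ^ 5 * X = X ^ 6 := by ring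
      _ ≤ _ := hx6
  have h1X : 1 ≤ Real.log lam / X := (one_le_pow₀ hx1).trans hX5
  have hn5 : ((n : ℝ) + 1) ^ 5 ≤ Real.log lam / X := (pow_le_pow_left₀ hn1.le hnX 5).trans hX5
  have hgrow : growth k α lam * c ^ (1 / α) = Real.log lam / X := by
    simp only [growth, hX, hx]
    rw [Real.div_rpow hl0.le hc.le]
    field_simp
  have hg0 : 0 ≤ growth k α lam := div_nonneg hlog0 (Real.rpow_nonneg hl0.le _)
  rw [Real.norm_of_nonneg hg0, mul_assoc, mul_comm (c ^ _), hgrow]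
  have : 4 * Real.log lam / X = 4 * (Real.log lam / X) := by ring
  have hKX : K ≤ K * (Real.log lam / X) := le_mul_of_one_le_right (by linarith) h1X
  calc _ ≤ _ := hbound
    _ ≤ 2 * (4 * Real.log lam / X + K) + 2 * K + 39 * (Real.log lam / X) := by gcongr
    _ ≤ _ := by rw [this]; linarith

/-! ### Iterated logarithms beyond an explicit threshold -/

section IteratedLogReal

variable {D : ℝ} {k : ℕ}

/-- Beyond `D`, the first `k` iterated logarithms are positive and monotone. -/
theorem iterate_log_pos_and_le (hD0 : 0 < D) (hD : ∀ j, 1 ≤ j → j ≤ k → 2 ≤ Real.log^[j] D)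
    {x y : ℝ} (hx : D ≤ x) (hxy : x ≤ y) {j : ℕ} (hj : j ≤ k) :
    0 < Real.log^[j] D ∧ Real.log^[j] D ≤ Real.log^[j] x ∧ Real.log^[j] x ≤ Real.log^[j] y := by
  induction j with
  | zero => exact ⟨hD0, hx, hxy⟩
  | succ j ih =>
    obtain ⟨h1, h2, h3⟩ := ih (by omega)
    simp only [Function.iterate_succ_apply']
    refine ⟨?_, Real.log_le_log h1 h2, Real.log_le_log (h1.trans_le h2) h3⟩
    have := hD (j + 1) (by omega) hj
    rw [Function.iterate_succ_apply'] at this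
    linarith

theorem two_le_iterate_log (hD0 : 0 < D) (hD : ∀ j, 1 ≤ j → j ≤ k → 2 ≤ Real.log^[j] D)
    {x : ℝ} (hx : D ≤ x) {j : ℕ} (h1 : 1 ≤ j) (hj : j ≤ k) : 2 ≤ Real.log^[j] x :=
  (hD j h1 hj).trans (iterate_log_pos_and_le hD0 hD hx le_rfl hj).2.1

theorem iterate_exp_iterate_log (hD0 : 0 < D) (hD : ∀ j, 1 ≤ j → j ≤ k → 2 ≤ Real.log^[j] D)
    {x : ℝ} (hx : D ≤ x) {j : ℕ} (hj : j ≤ k) : Real.exp^[j] (Real.log^[j] x) = x := by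
  induction j with
  | zero => rfl
  | succ j ih =>
    have h := iterate_log_pos_and_le hD0 hD hx le_rfl (j := j) (by omega)
    rw [Function.iterate_succ_apply, Function.iterate_succ_apply',
      Real.exp_log (h.1.trans_le h.2.1), ih (by omega)]

end IteratedLogReal

/-! ### Holomorphic extension of the flat phase -/

section ComplexExtension

/-- The holomorphic extension of the flat phase to a neighbourhood of `(0, 1]`. -/
def complexPhase (k : ℕ) (s B δ : ℝ) (z : ℂ) : ℂ :=
  Complex.exp (-(B * Complex.log (1 / (δ * z)) * (Complex.log^[k] (1 / (δ * z))) ^ (s : ℂ)))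

/-- The derivative `1 / z` has norm at most 1 on this half-plane, so further logarithms never
enlarge an error. -/
theorem norm_log_sub_log_le {z w : ℂ} (hz : 1 ≤ z.re) (hw : 1 ≤ w.re) :
    ‖Complex.log z - Complex.log w‖ ≤ ‖z - w‖ := by
  have hconv : Convex ℝ {z : ℂ | 1 ≤ z.re} := convex_halfSpace_re_ge 1
  have := Convex.norm_image_sub_le_of_norm_hasDerivWithin_le (𝕜 := ℂ) (f := Complex.log)
    (f' := fun z => z⁻¹) (s := {z : ℂ | 1 ≤ z.re}) (C := 1) (x := w) (y := z)
    (fun x hx => (Complex.hasDerivAt_log (Or.inl (lt_of_lt_of_le one_pos hx))).hasDerivWithinAt)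
    (fun x hx => by
      rw [norm_inv]
      exact inv_le_one_of_one_le₀ (le_trans hx (Complex.re_le_norm x))) hconv hw hz
  simpa using this

/-- Continuity at `(1, 1)`, where the value is 1. The loss of one half is what turns `B` into `B /
2` in the complex decay. -/
theorem exists_re_mul_cpow_ge (s : ℝ) : ∃ ρ : ℝ, 0 < ρ ∧ ρ ≤ 1 ∧ ∀ u v : ℂ, ‖u - 1‖ ≤ ρ →
    ‖v - 1‖ ≤ ρ → 1 / 2 ≤ (u * v ^ (s : ℂ)).re := by
  have hc : ContinuousAt (fun p : ℂ × ℂ => (p.1 * p.2 ^ (s : ℂ)).re) (1, 1) := by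
    refine Complex.continuous_re.continuousAt.comp (continuousAt_fst.mul ?_)
    exact continuousAt_snd.cpow continuousAt_const (by simp)
  have h1 : ∀ᶠ p : ℂ × ℂ in 𝓝 (1, 1), 1 / 2 < (p.1 * p.2 ^ (s : ℂ)).re :=
    hc.eventually (lt_mem_nhds (by norm_num))
  obtain ⟨r, hr, hball⟩ := Metric.eventually_nhds_iff.1 h1
  refine ⟨min (r / 2) 1, by positivity, min_le_right _ _, fun u v hu hv => ?_⟩
  have hu' := hu.trans (min_le_left _ _)
  have hv' := hv.trans (min_le_left _ _)
  refine (hball (y := (u, v)) ?_).le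
  rw [Prod.dist_eq, max_lt_iff, dist_eq_norm, dist_eq_norm]
  exact ⟨by linarith, by linarith⟩

theorem exists_norm_log_inv_le {ρ : ℝ} (hρ : 0 < ρ) : ∃ η : ℝ, 0 < η ∧ η < 1 ∧ ∀ ζ : ℂ,
    ‖ζ - 1‖ ≤ η → ‖Complex.log ζ⁻¹‖ ≤ ρ := by
  have hc : ContinuousAt (fun ζ : ℂ => ‖Complex.log ζ⁻¹‖) 1 :=
    ((continuousAt_inv₀ one_ne_zero).clog (by simp)).norm
  have h1 : ∀ᶠ ζ : ℂ in 𝓝 1, ‖Complex.log ζ⁻¹‖ < ρ :=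
    hc.eventually (gt_mem_nhds (by simpa using hρ))
  obtain ⟨r, hr, hball⟩ := Metric.eventually_nhds_iff.1 h1
  refine ⟨min (r / 2) (1 / 2), by positivity, (min_le_right _ _).trans_lt (by norm_num),
    fun ζ hζ => ?_⟩
  have hζ' := hζ.trans (min_le_left _ _)
  refine (hball (y := ζ) ?_).le
  rw [dist_eq_norm]
  linarith

variable {D : ℝ} {k : ℕ} {ρ : ℝ}

/-- The real iterates are at least 2 and the error is at most 1, so the complex iterates stay in the
half-plane where `log` does not expand distances. -/
theorem norm_iterate_clog_sub_le (hD0 : 0 < D)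
    (hD : ∀ j, 1 ≤ j → j ≤ k → 2 ≤ Real.log^[j] D) (hρ : ρ ≤ 1) {x : ℝ} (hx : D ≤ x) {ζ : ℂ}
    (hζ : ‖Complex.log ζ - Real.log x‖ ≤ ρ) {j : ℕ} (h1 : 1 ≤ j) (hj : j ≤ k) :
    ‖Complex.log^[j] ζ - (Real.log^[j] x : ℝ)‖ ≤ ρ ∧ 1 ≤ (Complex.log^[j] ζ).re := by
  have hre : ∀ j, 1 ≤ j → j ≤ k → ‖Complex.log^[j] ζ - (Real.log^[j] x : ℝ)‖ ≤ ρ →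
      1 ≤ (Complex.log^[j] ζ).re := fun j h1 hj h => by
    have h2 := two_le_iterate_log hD0 hD hx h1 hj
    have h3 := (Complex.abs_re_le_norm _).trans h
    rw [Complex.sub_re, Complex.ofReal_re, abs_le] at h3
    linarith [h3.1]
  induction j, h1 using Nat.le_induction with
  | base => exact ⟨hζ, hre 1 le_rfl hj hζ⟩
  | succ j h1 ih =>
    obtain ⟨h2, h3⟩ := ih (by omega)
    have h4 := two_le_iterate_log hD0 hD hx h1 (by omega : j ≤ k)
    have key : ‖Complex.log^[j + 1] ζ - (Real.log^[j + 1] x : ℝ)‖ ≤ ρ := by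
      rw [Function.iterate_succ_apply', Function.iterate_succ_apply',
        Complex.ofReal_log (by linarith)]
      refine (norm_log_sub_log_le h3 ?_).trans h2
      rw [Complex.ofReal_re]; linarith
    exact ⟨key, hre _ (by omega) hj key⟩

theorem ofReal_iterate_log (hD0 : 0 < D) (hD : ∀ j, 1 ≤ j → j ≤ k → 2 ≤ Real.log^[j] D)
    {x : ℝ} (hx : D ≤ x) {j : ℕ} (hj : j ≤ k) :
    ((Real.log^[j] x : ℝ) : ℂ) = Complex.log^[j] (x : ℂ) := by
  induction j with
  | zero => rfl
  | succ j ih =>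
    have h := iterate_log_pos_and_le hD0 hD hx le_rfl (j := j) (by omega)
    rw [Function.iterate_succ_apply', Function.iterate_succ_apply',
      Complex.ofReal_log (h.1.trans_le h.2.1).le, ih (by omega)]

theorem differentiableAt_iterate_clog {ζ : ℂ} (hζ : ζ ∈ Complex.slitPlane) {j : ℕ}
    (h : ∀ i, 1 ≤ i → i < j → 1 ≤ (Complex.log^[i] ζ).re) :
    DifferentiableAt ℂ Complex.log^[j] ζ := by
  induction j with
  | zero => exact differentiableAt_id
  | succ j ih =>
    rw [Function.iterate_succ']
    refine DifferentiableAt.comp ζ (Complex.differentiableAt_log ?_)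
      (ih fun i h1 h2 => h i h1 (by omega))
    rcases Nat.eq_zero_or_pos j with rfl | hj
    · exact hζ
    · exact Or.inl (lt_of_lt_of_le one_pos (h j hj (by omega)))

/-- Dividing by `a, b ≥ 1` brings `u` and `v` within `ρ` of 1; the positive real factor `b` can be
pulled out of the complex power. -/
theorem exp_neg_re_le {s B : ℝ} (hB : 0 < B)
    (hρ : ∀ u v : ℂ, ‖u - 1‖ ≤ ρ → ‖v - 1‖ ≤ ρ → 1 / 2 ≤ (u * v ^ (s : ℂ)).re)
    {a b : ℝ} {u v : ℂ} (ha : 1 ≤ a) (hb : 1 ≤ b) (hu : ‖u - a‖ ≤ ρ) (hv : ‖v - b‖ ≤ ρ)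
    (hv0 : v ≠ 0) :
    ‖Complex.exp (-(B * u * v ^ (s : ℂ)))‖ ≤ Real.exp (-(B / 2 * a * b ^ s)) := by
  have ha0 : (a : ℂ) ≠ 0 := by exact_mod_cast (by linarith : a ≠ 0)
  have hb0 : (b : ℂ) ≠ 0 := by exact_mod_cast (by linarith : b ≠ 0)
  have hbp : 0 < b := by linarith
  have hscale : ∀ {c : ℝ} {w : ℂ}, 1 ≤ c → ‖w - c‖ ≤ ρ → ‖w / c - 1‖ ≤ ρ := fun {c w} hc hw => by
    have hc0 : (c : ℂ) ≠ 0 := by exact_mod_cast (by linarith : c ≠ 0)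
    rw [div_sub_one hc0, norm_div, Complex.norm_real, Real.norm_of_nonneg (by linarith)]
    exact (div_le_self (norm_nonneg _) hc).trans hw
  have h := hρ _ _ (hscale ha hu) (hscale hb hv)
  have hvb : v / b ≠ 0 := div_ne_zero hv0 hb0
  have hcpow : v ^ (s : ℂ) = ((b ^ s : ℝ) : ℂ) * (v / b) ^ (s : ℂ) := by
    conv_lhs => rw [← mul_div_cancel₀ v hb0]
    rw [Complex.cpow_def_of_ne_zero (by rw [mul_div_cancel₀ v hb0]; exact hv0),
      Complex.cpow_def_of_ne_zero hvb, Complex.log_ofReal_mul hbp hvb, add_mul, Complex.exp_add,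
      Real.rpow_def_of_pos hbp]
    push_cast
    rfl
  have hexp : (B : ℂ) * u * v ^ (s : ℂ)
      = ((B * a * b ^ s : ℝ) : ℂ) * (u / a * (v / b) ^ (s : ℂ)) := by
    rw [hcpow]
    push_cast
    field_simp
  rw [Complex.norm_exp, Complex.neg_re, hexp, Complex.re_ofReal_mul, Real.exp_le_exp]
  have : 0 ≤ B * a * b ^ s := by
    have := Real.rpow_nonneg hbp.le s
    positivity
  nlinarith

variable {s B δ η : ℝ}

/-- On the discs `|z - t| ≤ η t` the extension is holomorphic and decays like the real phase. -/
theorem complexPhase_estimate (hk : 1 ≤ k) (hB : 0 < B) (hδ : 0 < δ)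
    (hD : ∀ j, 1 ≤ j → j ≤ k → 2 ≤ Real.log^[j] (1 / δ)) (hρ1 : ρ ≤ 1)
    (hρ : ∀ u v : ℂ, ‖u - 1‖ ≤ ρ → ‖v - 1‖ ≤ ρ → 1 / 2 ≤ (u * v ^ (s : ℂ)).re)
    (hη1 : η < 1) (hη : ∀ ζ : ℂ, ‖ζ - 1‖ ≤ η → ‖Complex.log ζ⁻¹‖ ≤ ρ)
    {t : ℝ} (ht : t ∈ Ioc (0 : ℝ) 1) {z : ℂ} (hz : z ∈ Metric.closedBall (t : ℂ) (η * t)) :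
    DifferentiableAt ℂ (complexPhase k s B δ) z ∧
      ‖complexPhase k s B δ z‖ ≤ Real.exp
        (-(B / 2 * Real.log (1 / (δ * t)) * Real.log^[k] (1 / (δ * t)) ^ s)) := by
  have ht0 : 0 < t := ht.1
  have htc : (t : ℂ) ≠ 0 := by exact_mod_cast ht0.ne'
  have hδc : (δ : ℂ) ≠ 0 := by exact_mod_cast hδ.ne'
  set x := 1 / (δ * t) with hx
  have hx0 : 0 < x := by positivity
  have hDx : 1 / δ ≤ x := by
    rw [hx]
    exact one_div_le_one_div_of_le (by positivity) (mul_le_of_le_one_right hδ.le ht.2)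
  set ζ := z / t with hζdef
  have hζ : ‖ζ - 1‖ ≤ η := by
    rw [hζdef, div_sub_one htc, norm_div, Complex.norm_real, Real.norm_of_nonneg ht0.le,
      div_le_iff₀ ht0, ← dist_eq_norm]
    exact hz
  have hζre : 0 < ζ.re := by
    have := (Complex.abs_re_le_norm _).trans hζ
    rw [Complex.sub_re, Complex.one_re, abs_le] at this
    linarith [this.1]
  have hζ0 : ζ ≠ 0 := fun h => by simp [h] at hζre
  have hz0 : z ≠ 0 := fun h => hζ0 (by rw [hζdef, h, zero_div])
  have hfac : 1 / (δ * z) = (x : ℂ) * ζ⁻¹ := by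
    rw [hx, hζdef]
    push_cast
    field_simp
  have hlog : Complex.log (1 / (δ * z)) - (Real.log x : ℝ) = Complex.log ζ⁻¹ := by
    rw [hfac, Complex.log_ofReal_mul hx0 (inv_ne_zero hζ0)]
    ring
  have hlogle : ‖Complex.log (1 / (δ * z)) - (Real.log x : ℝ)‖ ≤ ρ := by
    rw [hlog]; exact hη ζ hζ
  have hslit : 1 / (δ * z) ∈ Complex.slitPlane := by
    refine Or.inl ?_
    rw [hfac, Complex.re_ofReal_mul, Complex.inv_re]
    exact mul_pos hx0 (div_pos hζre (Complex.normSq_pos.2 hζ0))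
  have hit := fun j h1 hj => norm_iterate_clog_sub_le (one_div_pos.2 hδ) hD hρ1 hDx hlogle
    (j := j) h1 hj
  have hkre := (hit k hk le_rfl).2
  have hkslit : Complex.log^[k] (1 / (δ * z)) ∈ Complex.slitPlane :=
    Or.inl (lt_of_lt_of_le one_pos hkre)
  constructor
  · have hin : DifferentiableAt ℂ (fun z : ℂ => 1 / ((δ : ℂ) * z)) z :=
      (differentiableAt_const _).div (by fun_prop) (mul_ne_zero hδc hz0)
    have hl1 : DifferentiableAt ℂ (fun z : ℂ => Complex.log (1 / ((δ : ℂ) * z))) z :=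
      hin.clog hslit
    have hlk : DifferentiableAt ℂ (fun z : ℂ => Complex.log^[k] (1 / ((δ : ℂ) * z))) z :=
      (differentiableAt_iterate_clog hslit fun i h1 h2 => (hit i h1 h2.le).2).comp z hin
    exact (((hl1.const_mul _).mul (hlk.cpow (differentiableAt_const _) hkslit)).neg).cexp
  · have h2 : ∀ j, 1 ≤ j → j ≤ k → 1 ≤ Real.log^[j] x := fun j h1 hj => by
      have := two_le_iterate_log (one_div_pos.2 hδ) hD hDx h1 hj
      linarith
    exact exp_neg_re_le hB hρ (h2 1 le_rfl hk) (h2 k hk le_rfl) hlogle (hit k hk le_rfl).1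
      (Complex.slitPlane_ne_zero hkslit)

theorem complexPhase_re_eq_flatPhase {α : ℝ} (hk : 1 ≤ k) (hδ : 0 < δ)
    (hD : ∀ j, 1 ≤ j → j ≤ k → 2 ≤ Real.log^[j] (1 / δ)) {t : ℝ} (ht : t ∈ Ioc (0 : ℝ) 1) :
    (complexPhase k (1 / α) B δ t).re = flatPhase k α B δ t := by
  have ht0 : 0 < t := ht.1
  have hDx : 1 / δ ≤ 1 / (δ * t) :=
    one_div_le_one_div_of_le (by positivity) (mul_le_of_le_one_right hδ.le ht.2)
  have hD0 := one_div_pos.2 hδ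
  have h1 : (1 : ℂ) / (δ * t) = ((1 / (δ * t) : ℝ) : ℂ) := by push_cast; rfl
  have h2 := ofReal_iterate_log hD0 hD hDx (le_refl k)
  have h3 := ofReal_iterate_log hD0 hD hDx hk
  simp only [Function.iterate_one] at h3
  have h4 := two_le_iterate_log hD0 hD hDx hk le_rfl
  rw [flatPhase, if_neg (not_le.2 ht0), complexPhase, h1, ← h2, ← h3,
    ← Complex.ofReal_cpow (by linarith), ← Complex.ofReal_mul, ← Complex.ofReal_mul,
    ← Complex.ofReal_neg, Complex.exp_ofReal_re]

end ComplexExtension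

/-! ### Derivatives of the flat phase -/

/-- A sequence of functions, each the derivative of the previous one, consists of the iterated
derivatives of its first term. -/
theorem contDiffOn_of_hasDerivWithinAt_seq {S : Set ℝ} (hS : UniqueDiffOn ℝ S) {ψ : ℝ → ℝ}
    {f : ℕ → ℝ → ℝ} (h0 : ∀ t ∈ S, f 0 t = ψ t)
    (hf : ∀ n, ∀ t ∈ S, HasDerivWithinAt (f n) (f (n + 1) t) S t) :
    ContDiffOn ℝ ∞ ψ S ∧ ∀ n, ∀ t ∈ S, iteratedDerivWithin n ψ S t = f n t := by
  have hit : ∀ n, ∀ t ∈ S, iteratedDerivWithin n ψ S t = f n t := by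
    intro n
    induction n with
    | zero => intro t ht; rw [iteratedDerivWithin_zero, h0 t ht]
    | succ n ih =>
      intro t ht
      rw [iteratedDerivWithin_succ, derivWithin_congr ih (ih t ht)]
      exact (hf n t ht).derivWithin (hS t ht)
  refine ⟨contDiffOn_of_differentiableOn_deriv fun n _ t ht => ?_, hit⟩
  exact ((hf n t ht).congr (hit n) (hit n t ht)).differentiableWithinAt

theorem differentiableOn_iteratedDeriv {F : ℂ → ℂ} {U : Set ℂ} (hU : IsOpen U)
    (hF : DifferentiableOn ℂ F U) (n : ℕ) : DifferentiableOn ℂ (iteratedDeriv n F) U := by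
  induction n with
  | zero => rwa [iteratedDeriv_zero]
  | succ n ih => rw [iteratedDeriv_succ]; exact ih.deriv hU

/-- The majorant `exp (q exp^{(k-1)} ((2q/B)^α))` of `t^{-q}` times the decay of the phase. -/
def decayBound (k : ℕ) (α B : ℝ) (q : ℕ) : ℝ :=
  Real.exp (q * Real.exp^[k - 1] ((2 * q / B) ^ α))

section FlatPhase

variable {k : ℕ} {α B δ : ℝ}

/-- With `L = log x` and `ℓ = log^{(k)} x`, the left side is at most `exp(L (q - (B/2) ℓ^{1/α}))`.
Either the exponent is nonpositive, or `ℓ < (2q/B)^α`, which bounds `L = exp^{(k-1)} ℓ`. -/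
theorem pow_mul_exp_le_decayBound (hk : 2 ≤ k) (hα : 0 < α) (hB : 0 < B) (hδ : 0 < δ)
    (hD : ∀ j, 1 ≤ j → j ≤ k → 2 ≤ Real.log^[j] (1 / δ)) {t : ℝ} (ht : t ∈ Ioc (0 : ℝ) 1)
    (q : ℕ) :
    (1 / t) ^ q * Real.exp
      (-(B / 2 * Real.log (1 / (δ * t)) * Real.log^[k] (1 / (δ * t)) ^ (1 / α)))
      ≤ decayBound k α B q := by
  have ht0 : 0 < t := ht.1
  have hD0 := one_div_pos.2 hδ
  have hDx : 1 / δ ≤ 1 / (δ * t) :=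
    one_div_le_one_div_of_le (by positivity) (mul_le_of_le_one_right hδ.le ht.2)
  set x := 1 / (δ * t) with hx
  have hx0 : 0 < x := by positivity
  set ℓ := Real.log^[k] x with hℓ
  have hℓ2 : 2 ≤ ℓ := two_le_iterate_log hD0 hD hDx (by omega) le_rfl
  have hL2 : 2 ≤ Real.log x := two_le_iterate_log hD0 hD hDx (j := 1) le_rfl (by omega)
  have hL : Real.log x = Real.exp^[k - 1] ℓ := by
    have h := iterate_exp_iterate_log hD0 hD hDx (le_refl k)
    obtain ⟨i, rfl⟩ : ∃ i, k = i + 1 := ⟨k - 1, by omega⟩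
    rw [Function.iterate_succ_apply'] at h
    rw [Nat.add_sub_cancel, ← Real.log_exp (Real.exp^[i] ℓ), h]
  have hδ1 : δ ≤ 1 := by
    have h1 : 2 ≤ Real.log (1 / δ) := hD 1 le_rfl (by omega)
    by_contra h
    rw [not_le] at h
    have : Real.log (1 / δ) ≤ 0 :=
      Real.log_nonpos hD0.le ((div_le_one hδ).2 h.le)
    linarith
  have htx : 1 / t ≤ Real.exp (Real.log x) := by
    rw [Real.exp_log hx0, hx]
    exact one_div_le_one_div_of_le (by positivity) (mul_le_of_le_one_left ht0.le hδ1)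
  have hE0 : 0 ≤ Real.exp^[k - 1] ((2 * q / B) ^ α) := by
    obtain ⟨i, hi⟩ : ∃ i, k - 1 = i + 1 := ⟨k - 2, by omega⟩
    rw [hi, Function.iterate_succ_apply']
    exact (Real.exp_pos _).le
  calc _ ≤ Real.exp (Real.log x) ^ q * Real.exp (-(B / 2 * Real.log x * ℓ ^ (1 / α))) := by
        gcongr
    _ = Real.exp (q * Real.log x - B / 2 * Real.log x * ℓ ^ (1 / α)) := by
        rw [← Real.exp_nat_mul, ← Real.exp_add, sub_eq_add_neg]
    _ ≤ _ := by
        rw [decayBound, Real.exp_le_exp]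
        rcases le_or_gt (2 * q / B) (ℓ ^ (1 / α)) with h | h
        · refine le_trans ?_ (by positivity : (0 : ℝ) ≤ q * Real.exp^[k - 1] ((2 * q / B) ^ α))
          rw [div_le_iff₀ hB] at h
          nlinarith
        · have hle : ℓ ≤ (2 * q / B) ^ α := by
            calc ℓ = (ℓ ^ (1 / α)) ^ α := by
                  rw [← Real.rpow_mul (by linarith), one_div_mul_cancel hα.ne', Real.rpow_one]
              _ ≤ _ := Real.rpow_le_rpow (Real.rpow_nonneg (by linarith) _) h.le hα.le
          have h1 : Real.log x ≤ Real.exp^[k - 1] ((2 * q / B) ^ α) :=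
            hL.trans_le (monotone_iterate_exp _ hle)
          have h2 : 0 ≤ B / 2 * Real.log x * ℓ ^ (1 / α) := by
            have := Real.rpow_nonneg (by linarith : 0 ≤ ℓ) (1 / α)
            positivity
          have h3 : (q : ℝ) * Real.log x ≤ q * Real.exp^[k - 1] ((2 * q / B) ^ α) := by gcongr
          linarith

/-- The successive derivatives of the flat phase, with bounds that show flatness. -/
theorem exists_flatPhase_derivatives (hk : 2 ≤ k) (hα : 0 < α) (hB : 0 < B) (hδ : 0 < δ)
    (hD : ∀ j, 1 ≤ j → j ≤ k → 2 ≤ Real.log^[j] (1 / δ)) :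
    ∃ (f : ℕ → ℝ → ℝ) (η : ℝ), 0 < η ∧ (∀ t ∈ I, f 0 t = flatPhase k α B δ t) ∧
      (∀ n, ∀ t ∈ I, HasDerivWithinAt (f n) (f (n + 1) t) I t) ∧ (∀ n, f n 0 = 0) ∧
      ∀ n q : ℕ, ∀ t ∈ I,
        |f n t| ≤ n.factorial * η⁻¹ ^ n * decayBound k α B (n + q) * |t| ^ q := by
  obtain ⟨ρ, hρ0, hρ1, hρ⟩ := exists_re_mul_cpow_ge (1 / α)
  obtain ⟨η, hη0, hη1, hη⟩ := exists_norm_log_inv_le hρ0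
  set F := complexPhase k (1 / α) B δ with hF
  have hest := fun {t : ℝ} (ht : t ∈ Ioc (0 : ℝ) 1) {z : ℂ} hz =>
    complexPhase_estimate (k := k) (by omega) hB hδ hD hρ1 hρ hη1 hη ht (z := z) hz
  set f : ℕ → ℝ → ℝ := fun n t => if t ≤ 0 then 0 else (iteratedDeriv n F t).re with hf
  have hneg : ∀ n t, t ≤ 0 → f n t = 0 := fun n t ht => by simp [hf, ht]
  have hpos : ∀ n t, 0 < t → f n t = (iteratedDeriv n F t).re := fun n t ht => by
    simp [hf, not_le.2 ht]
  have hdb : ∀ q, 0 < decayBound k α B q := fun q => Real.exp_pos _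
  have hbound : ∀ n q : ℕ, ∀ t ∈ I,
      |f n t| ≤ n.factorial * η⁻¹ ^ n * decayBound k α B (n + q) * |t| ^ q := by
    intro n q t ht
    rcases le_or_gt t 0 with h | h
    · rw [hneg n t h, abs_zero]
      have := (hdb (n + q)).le
      positivity
    have htI : t ∈ Ioc (0 : ℝ) 1 := ⟨h, ht.2⟩
    -- Cauchy's estimate on the disc of radius `η t` costs `n! (η t)^{-n}`; the powers of `1 / t`
    -- are absorbed by the decay.
    have hdc : DiffContOnCl ℂ F (Metric.ball (t : ℂ) (η * t)) :=
      DifferentiableOn.diffContOnCl_ball (U := Metric.closedBall (t : ℂ) (η * t))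
        (fun z hz => (hest htI hz).1.differentiableWithinAt) le_rfl
    have hC := Complex.norm_iteratedDeriv_le_of_forall_mem_sphere_norm_le n (mul_pos hη0 h) hdc
      fun z hz => (hest htI (Metric.sphere_subset_closedBall hz)).2
    rw [hpos n t h, abs_of_pos h]
    refine (Complex.abs_re_le_norm _).trans (hC.trans ?_)
    have hdec := pow_mul_exp_le_decayBound hk hα hB hδ hD htI (n + q)
    set E := Real.exp (-(B / 2 * Real.log (1 / (δ * t)) * Real.log^[k] (1 / (δ * t)) ^ (1 / α)))
    calc n.factorial * E / (η * t) ^ n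
        = n.factorial * η⁻¹ ^ n * ((1 / t) ^ (n + q) * E) * t ^ q := by
          rw [mul_pow, pow_add, inv_pow, one_div, inv_pow, inv_pow]
          field_simp
      _ ≤ _ := by gcongr
  refine ⟨f, η, hη0, ?_, ?_, fun n => hneg n 0 le_rfl, hbound⟩
  · intro t ht
    rcases le_or_gt t 0 with h | h
    · rw [hneg 0 t h, flatPhase, if_pos h]
    · rw [hpos 0 t h, iteratedDeriv_zero]
      exact complexPhase_re_eq_flatPhase (by omega) hδ hD ⟨h, ht.2⟩
  · intro n t ht
    rcases lt_trichotomy t 0 with h | rfl | h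
    · rw [hneg (n + 1) t h.le]
      refine HasDerivAt.hasDerivWithinAt ((hasDerivAt_const t (0 : ℝ)).congr_of_eventuallyEq ?_)
      filter_upwards [Iio_mem_nhds h] with x hx
      exact hneg n x (le_of_lt hx)
    · rw [hneg (n + 1) 0 le_rfl, hasDerivWithinAt_iff_isLittleO]
      simp only [hneg n 0 le_rfl, sub_zero, smul_zero]
      -- The bound with `q = 2` is quadratic in `t`, so every `f n` has derivative zero at the
      -- origin.
      have hO : f n =O[𝓝[I] 0] fun t : ℝ => t ^ 2 := by
        refine IsBigO.of_bound (n.factorial * η⁻¹ ^ n * decayBound k α B (n + 2)) ?_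
        filter_upwards [self_mem_nhdsWithin] with t ht
        rw [Real.norm_eq_abs, norm_pow, Real.norm_eq_abs]
        exact hbound n 2 t ht
      exact hO.trans_isLittleO ((isLittleO_pow_id one_lt_two).mono nhdsWithin_le_nhds)
    · rw [hpos (n + 1) t h]
      have hd := (differentiableOn_iteratedDeriv Metric.isOpen_ball (fun z hz =>
        (hest ⟨h, ht.2⟩ (Metric.ball_subset_closedBall hz)).1.differentiableWithinAt) n
        : DifferentiableOn ℂ (iteratedDeriv n F) (Metric.ball (t : ℂ) (η * t)))
      have hd' := (hd.differentiableAt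
        (Metric.ball_mem_nhds _ (mul_pos hη0 h))).hasDerivAt.real_of_complex
      rw [← iteratedDeriv_succ] at hd'
      refine (hd'.congr_of_eventuallyEq ?_).hasDerivWithinAt
      filter_upwards [Ioi_mem_nhds h] with x hx
      exact hpos n x hx

end FlatPhase

/-! ### Comparison with the weight sequence -/

section Weight

/-- On the nonnegative axis `exp` has derivative at least 1, so it expands distances. -/
theorem sub_le_iterate_exp_sub {a b : ℝ} (ha : 0 ≤ a) (hab : a ≤ b) (j : ℕ) :
    0 ≤ Real.exp^[j] a ∧ b - a ≤ Real.exp^[j] b - Real.exp^[j] a := by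
  induction j with
  | zero => exact ⟨ha, le_rfl⟩
  | succ j ih =>
    obtain ⟨h0, h1⟩ := ih
    simp only [Function.iterate_succ_apply']
    refine ⟨(Real.exp_pos _).le, ?_⟩
    set u := Real.exp^[j] a
    set v := Real.exp^[j] b
    have h2 : Real.exp v = Real.exp u * Real.exp (v - u) := by
      rw [← Real.exp_add]; congr 1; ring
    have h3 := Real.add_one_le_exp (v - u)
    have h4 := Real.one_le_exp h0
    nlinarith

/-- The choice of `B` leaves `c / 2` against `c` in the innermost argument. After the exponentials
this gap gives a factor `exp(c n^α / 2)` one level below the top, which beats the `2 n^2` arising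
from `n! ≤ exp(n^2)` and the factor `n`. -/
theorem eventually_factorial_mul_decayBound_le {k : ℕ} (hk : 2 ≤ k) {c α B : ℝ} (hc : 0 < c)
    (hα : 0 < α) (hB : 0 < B) (hBc : (2 / B) ^ α = c / 2) :
    ∀ᶠ n : ℕ in atTop, n.factorial * decayBound k α B n ≤ weight k c α n := by
  obtain ⟨i, rfl⟩ : ∃ i, k = i + 2 := ⟨k - 2, by omega⟩
  have hlog : ∀ᶠ y : ℝ in atTop, ‖Real.log y‖ ≤ c / 8 * ‖y ^ α‖ :=
    (isLittleO_log_rpow_atTop hα).bound (by positivity)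
  have hlarge : ∀ᶠ y : ℝ in atTop, Real.log 2 ≤ c / 4 * y ^ α :=
    ((tendsto_rpow_atTop hα).const_mul_atTop (by positivity)).eventually_ge_atTop _
  filter_upwards [tendsto_natCast_atTop_atTop.eventually hlog,
    tendsto_natCast_atTop_atTop.eventually hlarge, eventually_ge_atTop 1] with n h1 h2 hn
  have hn1 : (1 : ℝ) ≤ n := by exact_mod_cast hn
  have hn0 : (0 : ℝ) < n := by linarith
  set y : ℝ := (n : ℝ) ^ α with hy
  have hy0 : 0 ≤ y := by positivity
  rw [Real.norm_of_nonneg (Real.log_nonneg hn1), Real.norm_of_nonneg hy0] at h1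
  have hhalf : (2 * (n : ℝ) / B) ^ α = c / 2 * y := by
    rw [mul_div_right_comm, Real.mul_rpow (by positivity) hn0.le, hBc]
  rw [decayBound, hhalf, weight, Function.iterate_succ_apply', show i + 2 - 1 = i + 1 by omega]
  have hfac : (n.factorial : ℝ) ≤ Real.exp (n * n) := by
    calc (n.factorial : ℝ) ≤ (n : ℝ) ^ n := by exact_mod_cast Nat.factorial_le_pow n
      _ ≤ Real.exp n ^ n := by
          gcongr
          linarith [Real.add_one_le_exp (n : ℝ)]
      _ = _ := by rw [← Real.exp_nat_mul]
  have hexpand := sub_le_iterate_exp_sub (a := c / 2 * y) (b := c * y) (by positivity)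
    (by nlinarith) i
  have hE : 2 * (n : ℝ) ^ 2 * Real.exp^[i + 1] (c / 2 * y) ≤ Real.exp^[i + 1] (c * y) := by
    have h3 : 2 * (n : ℝ) ^ 2 ≤ Real.exp (c / 2 * y) := by
      rw [← Real.log_le_iff_le_exp (by positivity), Real.log_mul (by norm_num) (by positivity),
        Real.log_pow]
      push_cast
      linarith
    rw [Function.iterate_succ_apply', Function.iterate_succ_apply']
    calc _ ≤ Real.exp (c / 2 * y) * Real.exp (Real.exp^[i] (c / 2 * y)) := by gcongr
      _ = Real.exp (c / 2 * y + Real.exp^[i] (c / 2 * y)) := by rw [Real.exp_add]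
      _ ≤ _ := by rw [Real.exp_le_exp]; linarith [hexpand.2]
  have hE1 : 1 ≤ Real.exp^[i + 1] (c / 2 * y) := by
    rw [Function.iterate_succ_apply']
    exact Real.one_le_exp hexpand.1
  calc _ ≤ Real.exp (n * n) * Real.exp (n * Real.exp^[i + 1] (c / 2 * y)) := by gcongr
    _ = Real.exp (n * n + n * Real.exp^[i + 1] (c / 2 * y)) := by rw [Real.exp_add]
    _ ≤ _ := by
      rw [Real.exp_le_exp]
      refine le_trans ?_ hE
      have h5 : (n : ℝ) * n ≤ n * n * Real.exp^[i + 1] (c / 2 * y) :=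
        le_mul_of_one_le_right (by positivity) hE1
      have h6 : n * Real.exp^[i + 1] (c / 2 * y) ≤ n * n * Real.exp^[i + 1] (c / 2 * y) := by
        have : (n : ℝ) ≤ n * n := le_mul_of_one_le_left hn0.le hn1
        gcongr
      nlinarith

/-- An eventual geometric bound becomes a bound for all indices after enlarging the constant. -/
theorem exists_forall_le_pow_mul {u M : ℕ → ℝ} (hM : ∀ n, 0 < M n) {b : ℝ} (hb : 0 ≤ b)
    (h : ∀ᶠ n in atTop, u n ≤ b ^ n * M n) : ∃ K, 0 < K ∧ ∀ n, u n ≤ K ^ (n + 1) * M n := by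
  obtain ⟨N, hN⟩ := eventually_atTop.1 h
  set S := ∑ n ∈ Finset.range N, |u n| / M n
  have hterm : ∀ n, 0 ≤ |u n| / M n := fun n => div_nonneg (abs_nonneg _) (hM n).le
  have hS : 0 ≤ S := Finset.sum_nonneg fun n _ => hterm n
  refine ⟨1 + b + S, by positivity, fun n => ?_⟩
  have hK1 : 1 ≤ 1 + b + S := by linarith
  rcases lt_or_ge n N with hn | hn
  · rw [← div_le_iff₀ (hM n)]
    calc u n / M n ≤ |u n| / M n := by
          have := (hM n).le
          gcongr
          exact le_abs_self _
      _ ≤ S := Finset.single_le_sum (f := fun n => |u n| / M n) (fun n _ => hterm n)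
          (Finset.mem_range.2 hn)
      _ ≤ 1 + b + S := by linarith
      _ ≤ _ := le_self_pow₀ hK1 (Nat.succ_ne_zero n)
  · have := (hM n).le
    calc u n ≤ b ^ n * M n := hN n hn
      _ ≤ (1 + b + S) ^ n * M n := by gcongr; linarith
      _ ≤ _ := by gcongr; exact Nat.le_succ n

end Weight

theorem denjoyCarleman_flatPhase {k : ℕ} (hk : 2 ≤ k) {c α B δ : ℝ} (hc : 0 < c) (hα : 0 < α)
    (hB : 0 < B) (hBc : (2 / B) ^ α = c / 2) (hδ : 0 < δ)
    (hD : ∀ j, 1 ≤ j → j ≤ k → 2 ≤ Real.log^[j] (1 / δ)) :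
    DenjoyCarleman (weight k c α) (flatPhase k α B δ) ∧ FlatAtZero (flatPhase k α B δ) := by
  obtain ⟨f, η, hη, h0, hder, hzero, hb⟩ := exists_flatPhase_derivatives hk hα hB hδ hD
  obtain ⟨hcd, hit⟩ := contDiffOn_of_hasDerivWithinAt_seq uniqueDiffOn_I h0 hder
  obtain ⟨K, hK, hKb⟩ := exists_forall_le_pow_mul
    (u := fun n => n.factorial * η⁻¹ ^ n * decayBound k α B n) (M := weight k c α)
    (weight_pos (by omega) c α) (inv_nonneg.2 hη.le) (by
      filter_upwards [eventually_factorial_mul_decayBound_le hk hc hα hB hBc] with n hn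
      calc _ = η⁻¹ ^ n * (n.factorial * decayBound k α B n) := by ring
        _ ≤ _ := by gcongr)
  refine ⟨⟨hcd, K, hK, fun n t ht => ?_⟩, fun n => ?_⟩
  · rw [hit n t ht]
    have := hb n 0 t ht
    rw [pow_zero, mul_one, add_zero] at this
    exact this.trans (hKb n)
  · rw [hit n 0 ⟨by norm_num, by norm_num⟩, hzero]

/-! ### Lower bound along a sequence of frequencies -/

/-- Averaging over `lam ∈ [Λ, 2Λ]` produces a frequency without cancellation. -/
theorem exists_integral_one_sub_cos_ge {ψ : ℝ → ℝ} {t₀ p : ℝ} (ht0 : 0 < t₀) (ht1 : t₀ < 1)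
    (hψ : ContinuousOn ψ (Icc t₀ 1)) (hp : 0 < p) (hpψ : ∀ t ∈ Icc t₀ 1, p ≤ ψ t) :
    ∃ lam ∈ Icc (4 / p) (2 * (4 / p)),
      Real.log t₀⁻¹ / 4 ≤ ∫ t in t₀..1, (1 - Real.cos (lam * ψ t)) / t := by
  by_contra! hcon
  -- The 4 makes the sine boundary terms, at most `2 / ψ t`, no more than `Λ / 2`. The double
  -- integral is then at least `Λ log(1/t₀) / 2`, twice what the contrary assumption permits.
  set Λ := 4 / p with hΛ
  have hΛ0 : 0 < Λ := by positivity
  have hΛ2 : Λ ≤ 2 * Λ := by linarith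
  have hlog : 0 < Real.log t₀⁻¹ := Real.log_pos ((one_lt_inv₀ ht0).2 ht1)
  have hpos : ∀ t ∈ Icc t₀ 1, 0 < t := fun t ht => ht0.trans_le ht.1
  have hcont : ContinuousOn (fun z : ℝ × ℝ => (1 - Real.cos (z.1 * ψ z.2)) / z.2)
      (Icc Λ (2 * Λ) ×ˢ Icc t₀ 1) := by
    have h1 : ContinuousOn (fun z : ℝ × ℝ => ψ z.2) (Icc Λ (2 * Λ) ×ˢ Icc t₀ 1) :=
      hψ.comp continuousOn_snd fun z hz => hz.2
    exact ContinuousOn.div (continuousOn_const.sub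
      (Real.continuous_cos.comp_continuousOn (continuousOn_fst.mul h1))) continuousOn_snd
      fun z hz => (hpos z.2 hz.2).ne'
  have hswap := intervalIntegral_intervalIntegral_swap
    (F := fun lam t => (1 - Real.cos (lam * ψ t)) / t) (a := Λ) (b := 2 * Λ) (c := t₀) (d := 1) (by
      rw [uIoc_of_le hΛ2, uIoc_of_le ht1.le]
      exact (hcont.integrableOn_compact (isCompact_Icc.prod isCompact_Icc)).mono_set
        (prod_mono Ioc_subset_Icc_self Ioc_subset_Icc_self))
  have hupper : ∫ lam in Λ..2 * Λ, ∫ t in t₀..1, (1 - Real.cos (lam * ψ t)) / t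
      ≤ Real.log t₀⁻¹ / 4 * Λ := by
    refine (Real.le_norm_self _).trans ((intervalIntegral.norm_integral_le_of_norm_le_const
      (C := Real.log t₀⁻¹ / 4) fun lam hlam => ?_).trans_eq ?_)
    · rw [uIoc_of_le hΛ2] at hlam
      rw [Real.norm_of_nonneg]
      · exact (hcon lam (Ioc_subset_Icc_self hlam)).le
      · exact intervalIntegral.integral_nonneg ht1.le fun t ht =>
          div_nonneg (sub_nonneg.2 (Real.cos_le_one _)) (hpos t ht).le
    · rw [abs_of_nonneg (by linarith)]; ring
  have hψpos : ∀ t ∈ Icc t₀ 1, 0 < ψ t := fun t ht => hp.trans_le (hpψ t ht)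
  have hval : ∀ t ∈ Icc t₀ 1, ∫ lam in Λ..2 * Λ, (1 - Real.cos (lam * ψ t)) / t
      = (2 * Λ - Λ - (ψ t)⁻¹ * (Real.sin (2 * Λ * ψ t) - Real.sin (Λ * ψ t))) / t := by
    intro t ht
    rw [intervalIntegral.integral_div, intervalIntegral.integral_sub (by simp)
      (Continuous.intervalIntegrable (by fun_prop) _ _),
      intervalIntegral.integral_comp_mul_right (fun x => Real.cos x) (hψpos t ht).ne',
      integral_cos, intervalIntegral.integral_const, smul_eq_mul, smul_eq_mul, mul_one]
  have hvalc : ContinuousOn (fun t => ∫ lam in Λ..2 * Λ, (1 - Real.cos (lam * ψ t)) / t)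
      (Icc t₀ 1) := by
    refine ContinuousOn.congr (ContinuousOn.div (continuousOn_const.sub
      ((hψ.inv₀ fun t ht => (hψpos t ht).ne').mul ?_)) continuousOn_id
      fun t ht => (hpos t ht).ne') hval
    fun_prop
  have hinner : ∀ t ∈ Icc t₀ 1,
      Λ / 2 * t⁻¹ ≤ ∫ lam in Λ..2 * Λ, (1 - Real.cos (lam * ψ t)) / t := by
    intro t ht
    have ht' := hpos t ht
    have hΛψ : 4 ≤ Λ * ψ t := by
      calc 4 = Λ * p := by rw [hΛ, div_mul_cancel₀ _ hp.ne']
        _ ≤ _ := by gcongr; exact hpψ t ht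
    rw [hval t ht, ← div_eq_mul_inv]
    gcongr
    have h1 : (ψ t)⁻¹ * (Real.sin (2 * Λ * ψ t) - Real.sin (Λ * ψ t)) ≤ Λ / 2 := by
      rw [inv_mul_le_iff₀ (hψpos t ht)]
      linarith [Real.sin_le_one (2 * Λ * ψ t), Real.neg_one_le_sin (Λ * ψ t)]
    linarith
  have hlower : Λ / 2 * Real.log t₀⁻¹
      ≤ ∫ t in t₀..1, ∫ lam in Λ..2 * Λ, (1 - Real.cos (lam * ψ t)) / t := by
    have hlogval : ∫ t in t₀..1, Λ / 2 * t⁻¹ = Λ / 2 * Real.log t₀⁻¹ := by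
      rw [intervalIntegral.integral_const_mul, integral_inv_of_pos ht0 one_pos, one_div]
    rw [← hlogval]
    refine intervalIntegral.integral_mono_on ht1.le ?_ ?_ hinner
    · refine ContinuousOn.intervalIntegrable ?_
      rw [uIcc_of_le ht1.le]
      exact continuousOn_const.mul (continuousOn_id.inv₀ fun t ht => (hpos t ht).ne')
    · exact ContinuousOn.intervalIntegrable (by rwa [uIcc_of_le ht1.le])
  rw [hswap] at hupper
  have : 0 < Λ * Real.log t₀⁻¹ := by positivity
  linarith

variable {k : ℕ} {α B δ : ℝ}

theorem flatPhase_of_nonpos {t : ℝ} (ht : t ≤ 0) : flatPhase k α B δ t = 0 := if_pos ht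

theorem flatPhase_of_pos {t : ℝ} (ht : 0 < t) : flatPhase k α B δ t =
    Real.exp (-(B * Real.log (1 / (δ * t)) * (Real.log^[k] (1 / (δ * t))) ^ (1 / α))) :=
  if_neg (not_le.2 ht)

theorem flatPhase_le (hk : 2 ≤ k) (hα : 0 < α) (hB : 0 < B) (hδ : 0 < δ)
    (hD : ∀ j, 1 ≤ j → j ≤ k → 2 ≤ Real.log^[j] (1 / δ)) {t u : ℝ} (ht : 0 < t) (htu : t ≤ u)
    (hu : u ≤ 1) : flatPhase k α B δ t ≤ flatPhase k α B δ u := by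
  have hu0 : 0 < u := ht.trans_le htu
  have hD0 := one_div_pos.2 hδ
  have hDx : 1 / δ ≤ 1 / (δ * u) :=
    one_div_le_one_div_of_le (by positivity) (mul_le_of_le_one_right hδ.le hu)
  have hxy : 1 / (δ * u) ≤ 1 / (δ * t) := one_div_le_one_div_of_le (by positivity) (by gcongr)
  have h1 := (iterate_log_pos_and_le hD0 hD hDx hxy (j := 1) (by omega)).2.2
  have hk' := (iterate_log_pos_and_le hD0 hD hDx hxy (le_refl k)).2.2
  have h2 : 2 ≤ Real.log (1 / (δ * u)) :=
    two_le_iterate_log hD0 hD hDx (j := 1) le_rfl (by omega)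
  have h3 := two_le_iterate_log hD0 hD hDx (by omega) (le_refl k)
  simp only [Function.iterate_one] at h1
  rw [flatPhase_of_pos ht, flatPhase_of_pos hu0, Real.exp_le_exp, neg_le_neg_iff]
  have h4 : 0 ≤ Real.log^[k] (1 / (δ * u)) ^ (1 / α) := Real.rpow_nonneg (by linarith) _
  have h5 : 0 ≤ B * Real.log (1 / (δ * t)) := mul_nonneg hB.le (by linarith)
  gcongr

/-- The real part of `m` bounds its norm from below. -/
theorem integral_one_sub_cos_le_norm_m {M : ℕ → ℝ}
    (hψ : DenjoyCarleman M (flatPhase k α B δ)) (lam : ℝ) {t₀ : ℝ} (ht0 : 0 < t₀) (ht1 : t₀ ≤ 1) :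
    ∫ t in t₀..1, (1 - Real.cos (lam * flatPhase k α B δ t)) / t
      ≤ ‖m (flatPhase k α B δ) lam‖ := by
  set ψ := flatPhase k α B δ
  have hint := hψ.integrableOn_oddKernel lam
  have hre : ∀ t ∈ Ioc (0 : ℝ) 1, (1 - Real.cos (lam * ψ t)) / t
      = -(oddKernel (fun t => lam * ψ t) t).re := fun t ht => by
    have hneg : ψ (-t) = 0 := flatPhase_of_nonpos (by linarith [ht.1])
    simp only [oddKernel, hneg, mul_zero, Complex.ofReal_zero, Complex.exp_zero,
      Complex.div_ofReal_re, Complex.sub_re, Complex.one_re]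
    rw [mul_comm Complex.I, Complex.exp_ofReal_mul_I_re]
    ring
  have hintr : IntegrableOn (fun t => (1 - Real.cos (lam * ψ t)) / t) (Ioc 0 1) :=
    (integrableOn_congr_fun hre measurableSet_Ioc).2 hint.re.neg
  calc _ = ∫ t in Ioc t₀ 1, (1 - Real.cos (lam * ψ t)) / t :=
        intervalIntegral.integral_of_le ht1
    _ ≤ ∫ t in Ioc 0 1, (1 - Real.cos (lam * ψ t)) / t := by
        refine setIntegral_mono_set hintr ?_
          (LE.le.eventuallyLE (Ioc_subset_Ioc ht0.le le_rfl))
        refine (ae_restrict_mem measurableSet_Ioc).mono fun t ht => ?_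
        exact div_nonneg (sub_nonneg.2 (Real.cos_le_one _)) ht.1.le
    _ = ∫ t in Ioc 0 1, -(oddKernel (fun t => lam * ψ t) t).re :=
        setIntegral_congr_fun measurableSet_Ioc hre
    _ = -(m ψ lam).re := by
        rw [integral_neg, hψ.m_eq]
        exact congrArg Neg.neg (integral_re hint)
    _ ≤ ‖m ψ lam‖ := (neg_le_abs _).trans (Complex.abs_re_le_norm _)

theorem exists_frequency (hk : 2 ≤ k) (hα : 0 < α) (hB : 0 < B) (hδ : 0 < δ)
    (hD : ∀ j, 1 ≤ j → j ≤ k → 2 ≤ Real.log^[j] (1 / δ)) {M : ℕ → ℝ}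
    (hψ : DenjoyCarleman M (flatPhase k α B δ)) {t : ℝ} (ht0 : 0 < t) (ht1 : t < 1) :
    ∃ lam ∈ Icc (4 / flatPhase k α B δ t) (2 * (4 / flatPhase k α B δ t)),
      Real.log t⁻¹ / 4 ≤ ‖m (flatPhase k α B δ) lam‖ := by
  have hsub : Icc t 1 ⊆ I := Icc_subset_Icc (by linarith) le_rfl
  obtain ⟨lam, hlam, hge⟩ := exists_integral_one_sub_cos_ge ht0 ht1
    (hψ.1.continuousOn.mono hsub)
    (by rw [flatPhase_of_pos ht0]; exact Real.exp_pos _ : 0 < flatPhase k α B δ t)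
    fun u hu => flatPhase_le hk hα hB hδ hD ht0 hu.1 hu.2
  exact ⟨lam, hlam, hge.trans (integral_one_sub_cos_le_norm_m hψ lam ht0 ht1.le)⟩

/-- Along the frequencies `lam ∈ [4/ψ(t), 8/ψ(t)]` the growth function is at most a multiple of
`log (1/t)` as `t → 0`. -/
theorem eventually_growth_le (hk : 2 ≤ k) (hα : 0 < α) (hB : 0 < B) (hδ : 0 < δ)
    (hD : ∀ j, 1 ≤ j → j ≤ k → 2 ≤ Real.log^[j] (1 / δ)) :
    ∀ᶠ t in 𝓝[>] (0 : ℝ),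
      ∀ lam ∈ Icc (4 / flatPhase k α B δ t) (2 * (4 / flatPhase k α B δ t)),
        t⁻¹ ≤ lam ∧ 0 ≤ growth k α lam ∧ growth k α lam ≤ 18 * B * Real.log t⁻¹ := by
  have hxtop : Tendsto (fun t : ℝ => 1 / (δ * t)) (𝓝[>] 0) atTop := by
    simp_rw [one_div, mul_inv]
    exact tendsto_inv_nhdsGT_zero.const_mul_atTop (inv_pos.2 hδ)
  have hℓtop : Tendsto (fun x : ℝ => B * Real.log^[k] x ^ (1 / α)) atTop atTop :=
    ((tendsto_rpow_atTop (by positivity)).comp (tendsto_iterate_log_atTop k)).const_mul_atTop hB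
  filter_upwards [Ioc_mem_nhdsGT (zero_lt_one (α := ℝ)),
    (hℓtop.comp hxtop).eventually_ge_atTop 1,
    tendsto_inv_nhdsGT_zero.eventually_ge_atTop (1 / δ)] with t ht hBℓ htδ lam hlam
  simp only [Function.comp_apply] at hBℓ
  have ht0 : 0 < t := ht.1
  have hD0 := one_div_pos.2 hδ
  have hDx : 1 / δ ≤ 1 / (δ * t) :=
    one_div_le_one_div_of_le (by positivity) (mul_le_of_le_one_right hδ.le ht.2)
  have hxe : 1 / (δ * t) = 1 / δ * t⁻¹ := by rw [one_div, mul_inv, one_div]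
  have hL2 : 2 ≤ Real.log (1 / (δ * t)) :=
    two_le_iterate_log hD0 hD hDx (j := 1) le_rfl (by omega)
  have hℓ2 := two_le_iterate_log hD0 hD hDx (by omega) (le_refl k)
  have hD2 : 2 ≤ Real.log (1 / δ) := hD 1 le_rfl (by omega)
  have hLle : Real.log (1 / (δ * t)) ≤ 2 * Real.log t⁻¹ := by
    rw [hxe, Real.log_mul hD0.ne' (by positivity)]
    linarith [Real.log_le_log hD0 htδ]
  have hD1 : 1 ≤ 1 / δ := by
    have := Real.add_one_le_exp (Real.log (1 / δ))
    rw [Real.exp_log hD0] at this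
    linarith
  rw [flatPhase_of_pos ht0, Real.exp_neg, div_inv_eq_mul] at hlam
  have hx0 : 0 < 1 / (δ * t) := by positivity
  set x := 1 / (δ * t) with hx
  set L := Real.log x with hL
  set P := Real.log^[k] x ^ (1 / α) with hP
  have hP0 : 0 < P := Real.rpow_pos_of_pos (by linarith) _
  -- This uses `B * P ≥ 1`, true for small `t`; it gives `x ≤ lam`, so the iterated logarithm of
  -- `lam` is at least that of `x`.
  have hBLP : L ≤ B * L * P := by nlinarith
  have hxlam : x ≤ lam := by
    calc x = Real.exp L := (Real.exp_log hx0).symm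
      _ ≤ Real.exp (B * L * P) := Real.exp_le_exp.2 hBLP
      _ ≤ 4 * Real.exp (B * L * P) := by linarith [Real.exp_pos (B * L * P)]
      _ ≤ lam := hlam.1
  have hlam0 : 0 < lam := hx0.trans_le hxlam
  have hitl := (iterate_log_pos_and_le hD0 hD hDx hxlam (le_refl k)).2.2
  have hlog0 : 0 ≤ Real.log lam := by
    have := Real.log_le_log hx0 hxlam
    linarith
  have hPl : P ≤ Real.log^[k] lam ^ (1 / α) :=
    Real.rpow_le_rpow (by linarith) hitl (by positivity)
  refine ⟨?_, div_nonneg hlog0 (hP0.le.trans hPl), ?_⟩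
  · refine le_trans ?_ hxlam
    rw [hxe]
    exact le_mul_of_one_le_left (by positivity) hD1
  -- The factor 9 absorbs `log 8 ≤ 8` into `8 * (B * L * P)`.
  · have hloglam : Real.log lam ≤ 9 * (B * L * P) := by
      have h1 := Real.log_le_log hlam0 hlam.2
      rw [← mul_assoc, Real.log_mul (by norm_num) (Real.exp_pos _).ne', Real.log_exp] at h1
      have h2 : Real.log (2 * 4) ≤ 2 * 4 := Real.log_le_self (by norm_num)
      linarith
    calc growth k α lam ≤ 9 * (B * L * P) / P := by
          rw [growth]
          gcongr
      _ = 9 * B * L := by field_simp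
      _ ≤ 9 * B * (2 * Real.log t⁻¹) := by gcongr
      _ = _ := by ring

/-- Use the frequencies found at `t = 1 / (n + 2)`: the upper half is the general bound, and 72 is
`18 * 4` from the growth comparison and the averaging. -/
theorem exists_sharp_sequence (hk : 2 ≤ k) {c : ℝ} (hc : 0 < c) (hα : 0 < α) (hB : 0 < B)
    (hδ : 0 < δ) (hD : ∀ j, 1 ≤ j → j ≤ k → 2 ≤ Real.log^[j] (1 / δ))
    (hψ : DenjoyCarleman (weight k c α) (flatPhase k α B δ)) :
    ∃ L : ℕ → ℝ, Tendsto L atTop atTop ∧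
      (fun n : ℕ => m (flatPhase k α B δ) (L n)) =Θ[atTop] (fun n : ℕ => growth k α (L n)) := by
  have hτ : ∀ n : ℕ, 0 < ((n : ℝ) + 2)⁻¹ ∧ ((n : ℝ) + 2)⁻¹ < 1 := fun n => by
    have : (0 : ℝ) ≤ n := by positivity
    exact ⟨by positivity, inv_lt_one_of_one_lt₀ (by linarith)⟩
  choose L hLmem hLge using fun n : ℕ => exists_frequency hk hα hB hδ hD hψ (hτ n).1 (hτ n).2
  have htop : Tendsto (fun n : ℕ => (n : ℝ) + 2) atTop atTop :=
    tendsto_atTop_add_const_right _ _ tendsto_natCast_atTop_atTop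
  have hτ0 : Tendsto (fun n : ℕ => ((n : ℝ) + 2)⁻¹) atTop (𝓝[>] 0) :=
    tendsto_inv_atTop_nhdsGT_zero.comp htop
  have hev := hτ0.eventually (eventually_growth_le hk hα hB hδ hD)
  have hLtop : Tendsto L atTop atTop := by
    refine tendsto_atTop_mono' _ ?_ htop
    filter_upwards [hev] with n hn
    have := (hn (L n) (hLmem n)).1
    rwa [inv_inv] at this
  refine ⟨L, hLtop, (hψ.m_isBigO_growth hk hc hα).comp_tendsto hLtop, ?_⟩
  refine IsBigO.of_bound (72 * B) ?_
  filter_upwards [hev] with n hn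
  obtain ⟨-, h2, h3⟩ := hn (L n) (hLmem n)
  rw [Real.norm_of_nonneg h2]
  calc _ ≤ _ := h3
    _ = 72 * B * (Real.log ((n : ℝ) + 2)⁻¹⁻¹ / 4) := by ring
    _ ≤ _ := by gcongr; exact hLge n

/-! ### Choice of the constants and conclusion -/

theorem iterate_log_iterate_exp (j : ℕ) (x : ℝ) : Real.log^[j] (Real.exp^[j] x) = x :=
  Function.LeftInverse.iterate Real.log_exp j x

theorem le_iterate_exp (j : ℕ) (x : ℝ) : x ≤ Real.exp^[j] x :=
  Function.id_le_iterate_of_id_le (fun y => by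
    have := Real.add_one_le_exp y
    simp only [id]; linarith) j x

end SteinWainger
end

theorem theorem8p1 (k : ℕ) (hk : 2 ≤ k) (c α : ℝ) (hc : 0 < c) (hα : 0 < α) :
    (∀ ψ : ℝ → ℝ, SteinWainger.DenjoyCarleman (SteinWainger.weight k c α) ψ →
      (∀ lam : ℝ, SteinWainger.HasPrincipalValue ψ lam (SteinWainger.m ψ lam)) ∧
      (fun lam : ℝ => SteinWainger.m ψ lam) =O[atTop]
        (fun lam : ℝ => SteinWainger.growth k α lam)) ∧
    (∃ B δ : ℝ, 0 < B ∧ 0 < δ ∧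
      (∀ j : ℕ, 1 ≤ j → j ≤ k → 2 ≤ Real.log^[j] (1 / δ)) ∧
      SteinWainger.DenjoyCarleman (SteinWainger.weight k c α)
        (SteinWainger.flatPhase k α B δ) ∧
      SteinWainger.FlatAtZero (SteinWainger.flatPhase k α B δ) ∧
      ∃ L : ℕ → ℝ, Tendsto L atTop atTop ∧
        (fun n : ℕ => SteinWainger.m (SteinWainger.flatPhase k α B δ) (L n)) =Θ[atTop]
          (fun n : ℕ => SteinWainger.growth k α (L n))) := by
  refine ⟨fun ψ hψ => ⟨fun lam => ?_, hψ.m_isBigO_growth hk hc hα⟩, ?_⟩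
  · rw [hψ.m_eq]
    exact hψ.hasPrincipalValue lam
  -- This `B` solves `(2 / B) ^ α = c / 2`.
  · have hB : 0 < 2 / (c / 2) ^ (1 / α) := by positivity
    have hBc : (2 / (2 / (c / 2) ^ (1 / α))) ^ α = c / 2 := by
      rw [div_div_cancel₀ (by norm_num), ← Real.rpow_mul (by positivity),
        one_div_mul_cancel hα.ne', Real.rpow_one]
    have hE : 0 < Real.exp^[k] 2 := lt_of_lt_of_le two_pos (SteinWainger.le_iterate_exp k 2)
    -- With this `δ`, the `j`-th iterated logarithm of `1 / δ` is the `(k - j)`-fold exponential of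
    -- 2, hence at least 2.
    have hδ : 0 < 1 / Real.exp^[k] 2 := one_div_pos.2 hE
    have hD : ∀ j : ℕ, 1 ≤ j → j ≤ k → 2 ≤ Real.log^[j] (1 / (1 / Real.exp^[k] 2)) := by
      intro j _ hj
      obtain ⟨i, rfl⟩ := Nat.exists_eq_add_of_le hj
      rw [one_div_one_div, Function.iterate_add_apply, SteinWainger.iterate_log_iterate_exp]
      exact SteinWainger.le_iterate_exp i 2
    obtain ⟨hψ, hflat⟩ := SteinWainger.denjoyCarleman_flatPhase hk hc hα hB hBc hδ hD
    exact ⟨_, _, hB, hδ, hD, hψ, hflat,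
      SteinWainger.exists_sharp_sequence hk hc hα hB hδ hD hψ⟩
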